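/- Let $d\in\{1,2,3\}$, $N\ge 1$, and let $\mathcal W\in L^1_{\mathrm{loc}}(\mathbb R^{dN};\mathbb R_+)$. Write $\mathbf X=(\mathbf x_1,\dots,\mathbf x_N)\in\mathbb R^{dN}$. Let $\mathfrak h$ be a separable complex Hilbert space and $\omega\ge 0$ an injective self-adjoint, possibly unbounded, operator on $\mathfrak h$. Let $\mathfrak h_\omega$ be the Hilbert completion of $\bigcap_{k}\mathscr D(\omega^k)$ for the scalar product $\langle x|\omega|y\rangle_{\mathfrak h}$; for $z\in\mathfrak h_\omega$ and $v\in\mathscr D(\omega^{-1/2})$ set $\langle z|v\rangle:=\langle\omega^{1/2}z|\omega^{-1/2}v\rangle_{\mathfrak h}$ and $\langle z|\omega|z\rangle:=\|z\|^2_{\mathfrak h_\omega}$. Consider one of the following quasi-classical Hamiltonians $\mathcal H_z$ on $L^2(\mathbb R^{dN})$: (a) (Nelson) $\mathcal H_z=\sum_{j}\bigl(-\Delta_j+2\Re\langle z|\lambda(\mathbf x_j)\rangle\bigr)+\mathcal W+\langle z|\omega|z\rangle$, where $z\in\mathfrak h_\omega$ and $\lambda,\omega^{-1/2}\lambda\in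 L^\infty(\mathbb R^d;\mathfrak h)$; (b) (Fröhlich polaron) $\mathfrak h=\mathfrak h_\omega=L^2(\mathbb R^d)$, $\omega=1$, $\mathcal H_z=\sum_j\bigl(-\Delta_j+\mathcal V_z(\mathbf x_j)\bigr)+\mathcal W+\|z\|^2$, where $\alpha>0$ and $\mathcal V_z(\mathbf x)=2\sqrt\alpha\,\Re\int\overline{z(\mathbf k)}\,|\mathbf k|^{-\frac{d-1}{2}}e^{-i\mathbf k\cdot\mathbf x}\,d\mathbf k$ is understood as the form $\sqrt\alpha\,(\mathcal V_{<,z}+\nabla\cdot\mathbf G_z)$ for a cut-off $\varrho>0$, with the bounded functions $\mathcal V_{<,z}(\mathbf x)=2\Re\int_{|\mathbf k|\le\varrho}\overline{z(\mathbf k)}|\mathbf k|^{-\frac{d-1}{2}}e^{-i\mathbf k\cdot\mathbf x}d\mathbf k$ and $\mathbf G_z(\mathbf x)=2\Re\int_{|\mathbf k|>\varrho}\overline{z(\mathbf k)}\,\tfrac{i\mathbf k}{|\mathbf k|}|\mathbf k|^{-\frac{d+1}{2}}e^{-i\mathbf k\cdot\mathbf x}d\mathbf k$, i.e. $\langle\psi|(\nabla\cdot\mathbf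 G_z)(\mathbf x_j)|\psi\rangle:=-2\Re\int\overline\psi\,\mathbf G_z(\mathbf x_j)\cdot\nabla_j\psi\,d\mathbf X$; (c) (Pauli–Fierz) $d=3$, $\mathcal H_z=\sum_j\frac1{2m_j}\bigl(-i\nabla_j+e\,\mathbf a_{z,j}(\mathbf x_j)\bigr)^2+\mathcal W+\langle z|\omega|z\rangle$, where $z\in\mathfrak h_\omega$, $m_j>0$, $e\in\mathbb R$, $\mathbf a_{z,j}(\mathbf x)=2\Re\langle z|\boldsymbol\lambda_j(\mathbf x)\rangle$, and $\lambda_{j,\ell},\omega^{-1/2}\lambda_{j,\ell}\in L^\infty(\mathbb R^3;\mathfrak h)$ for the components of $\boldsymbol\lambda_j=(\lambda_{j,1},\lambda_{j,2},\lambda_{j,3})$. Let $\mathcal E_{\mathrm{qc}}[\psi,z]=\langle\psi|\mathcal H_z|\psi\rangle$ be the quadratic form of $\mathcal H_z$, equal to $+\infty$ unless $\psi\in H^1(\mathbb R^{dN})$ and $\int\mathcal W|\psi|^2<\infty$. Define: - the Pekar functional $\mathcal E_{\mathrm{Pekar}}[\psi]$, which in cases (a), (b) is $\inf_{z}\mathcal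 E_{\mathrm{qc}}[\psi,z]$ and in case (c) is $\mathcal E_{\mathrm{qc}}[\psi,z_\psi]$, where $z_\psi$ is the critical point of $z\mapsto\mathcal E_{\mathrm{qc}}[\psi,z]$ (and $+\infty$ if $\psi$ is not in the form domain); - for a state-valued probability measure $\mathfrak m$, i.e. a Borel measure on $\mathfrak h_\omega$ with values in the nonnegative trace class operators on $L^2(\mathbb R^{dN})$, $\sigma$-additive in trace norm and with $\operatorname{tr}\mathfrak m(\mathfrak h_\omega)=1$, with Radon–Nikodým decomposition $d\mathfrak m(z)=\gamma_{\mathfrak m}(z)\,d\mu_{\mathfrak m}(z)$ into a probability measure $\mu_{\mathfrak m}$ and normalized density matrices $\gamma_{\mathfrak m}(z)$, the energy $\mathcal E_{\mathrm{svm}}[\mathfrak m]=\int d\mu_{\mathfrak m}(z)\operatorname{tr}[\gamma_{\mathfrak m}(z)\mathcal H_z]$; - for $\psi\in L^2(\mathbb R^{dN})$ and a Borel probability measure $\mu$ on $\mathfrak h_\omega$, the energy $\mathcal E_{\mathrm{pm}}[\psi,\mu]=\int d\mu(z)\,\mathcal E_{\mathrm{qc}}[\psi,z]$. Each functional is considered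 on the set of arguments with $\|\psi\|_2=1$ (where a wave function occurs) and with finite energy; a minimizer is an element of this set at which the functional equals its infimum over the set. Then, in each of the three models, the following are equivalent: $\mathcal E_{\mathrm{qc}}$ has a minimizer; $\mathcal E_{\mathrm{Pekar}}$ has a minimizer; $\mathcal E_{\mathrm{svm}}$ has a minimizer; $\mathcal E_{\mathrm{pm}}$ has a minimizer. Moreover, every minimizer $\mathfrak m$ of $\mathcal E_{\mathrm{svm}}$ is concentrated on the set of minimizers of $\mathcal E_{\mathrm{qc}}$: for $\mu_{\mathfrak m}$-almost every $z$ and every normalized eigenvector $\psi$ of $\gamma_{\mathfrak m}(z)$ with nonzero eigenvalue, $(\psi,z)$ is a minimizer of $\mathcal E_{\mathrm{qc}}$. -/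

import Mathlib

open MeasureTheory Set Filter Topology
open scoped ENNReal InnerProductSpace

noncomputable section

namespace QuasiClassical

/-! ### The particle space `L²(ℝ^{dN})` and its first order Sobolev space -/

/-- Configurations `X = (x₁, …, x_N)` of `N` particles in `ℝ^d`; the coordinate `(j, l)` is the
`l`-th component of `x_j`. -/
abbrev Config (d N : ℕ) : Type := EuclideanSpace ℝ (Fin N × Fin d)

/-- The position `x_j` of the `j`-th particle. -/
def pos {d N : ℕ} (j : Fin N) (X : Config d N) : EuclideanSpace ℝ (Fin d) :=
  WithLp.toLp 2 (fun l => X (j, l))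

/-- The Hilbert space `L²(ℝ^{dN}; ℂ)`. -/
abbrev Wave (d N : ℕ) : Type := Lp ℂ 2 (volume : Measure (Config d N))

/-- `g` is the weak partial derivative of `ψ` in the coordinate `i`. -/
def IsWeakPartial {d N : ℕ} (i : Fin N × Fin d) (ψ g : Wave d N) : Prop :=
  ∀ φ : Config d N → ℝ, ContDiff ℝ ((⊤ : ℕ∞) : WithTop ℕ∞) φ → HasCompactSupport φ →
    ∫ X, (fderiv ℝ φ X (EuclideanSpace.single i 1)) • ψ X = -∫ X, φ X • g X

/-- `ψ ∈ H¹(ℝ^{dN})`. -/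
def InH1 {d N : ℕ} (ψ : Wave d N) : Prop := ∀ i, ∃ g, IsWeakPartial i ψ g

open Classical in
/-- The weak partial derivative `∂_i ψ` (with value `0` if there is none in `L²`). -/
def weakPartial {d N : ℕ} (i : Fin N × Fin d) (ψ : Wave d N) : Wave d N :=
  if h : ∃ g, IsWeakPartial i ψ g then h.choose else 0

/-- The form domain of `-Δ + W`. -/
def FormDomain {d N : ℕ} (W : Config d N → ℝ) (ψ : Wave d N) : Prop :=
  InH1 ψ ∧ Integrable (fun X => W X * ‖ψ X‖ ^ 2)

/-- `W ∈ L¹_loc(ℝ^{dN}; ℝ₊)`. -/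
def IsPotential {d N : ℕ} (W : Config d N → ℝ) : Prop :=
  LocallyIntegrable W ∧ ∀ᵐ X, 0 ≤ W X

/-- The quadratic form `⟨ψ, (-Δ + W) ψ⟩` on its form domain. -/
def freeForm {d N : ℕ} (W : Config d N → ℝ) (ψ : Wave d N) : ℝ :=
  (∑ i, ‖weakPartial i ψ‖ ^ 2) + (∫ X, W X * ‖ψ X‖ ^ 2)

/-! ### The field: the operator `ω` and the space `𝔥_ω` -/

section Field

variable {𝔥 : Type*} [NormedAddCommGroup 𝔥] [InnerProductSpace ℂ 𝔥] [CompleteSpace 𝔥]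

/-- A nonnegative self-adjoint, possibly unbounded operator `ω` on `𝔥` which is injective, so that
it has a (possibly unbounded) inverse. -/
structure Dispersion (𝔥 : Type*) [NormedAddCommGroup 𝔥] [InnerProductSpace ℂ 𝔥]
    [CompleteSpace 𝔥] where
  op : 𝔥 →ₗ.[ℂ] 𝔥
  selfAdjoint : IsSelfAdjoint op
  nonneg : ∀ x : op.domain, 0 ≤ RCLike.re ⟪(x : 𝔥), op x⟫_ℂ
  injective : ∀ x : op.domain, op x = 0 → x = 0

/-- `σ = T^{1/2}`: `σ` is self-adjoint and nonnegative, and `σ² = T` (equality of graphs, hence also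
of domains). -/
structure IsPositiveSqrt (σ T : 𝔥 →ₗ.[ℂ] 𝔥) : Prop where
  selfAdjoint : IsSelfAdjoint σ
  nonneg : ∀ x : σ.domain, 0 ≤ RCLike.re ⟪(x : 𝔥), σ x⟫_ℂ
  sq : ∀ x y : 𝔥, (x, y) ∈ T.graph ↔ ∃ u, (x, u) ∈ σ.graph ∧ (u, y) ∈ σ.graph

open Classical in
/-- The value `T v` of a partially defined operator (`0` outside of its domain). -/
def applyOp (T : 𝔥 →ₗ.[ℂ] 𝔥) (v : 𝔥) : 𝔥 := if h : v ∈ T.domain then T ⟨v, h⟩ else 0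

namespace Dispersion

variable (ω : Dispersion 𝔥)

/-- The domain of `ω^k`. -/
def powDomain : ℕ → Submodule ℂ 𝔥
  | 0 => ⊤
  | k + 1 => ((powDomain k).comap ω.op.toFun).map ω.op.domain.subtype

/-- `⋂ₖ D(ω^k)`. -/
def smoothDomain : Submodule ℂ 𝔥 := ⨅ k, ω.powDomain k

theorem smoothDomain_le : ω.smoothDomain ≤ ω.op.domain := by
  intro x hx
  have h1 : x ∈ ω.powDomain 1 := (Submodule.mem_iInf _).1 hx 1
  obtain ⟨y, -, rfl⟩ := h1
  exact y.2

theorem symm (x y : ω.op.domain) : ⟪ω.op x, (y : 𝔥)⟫_ℂ = ⟪(x : 𝔥), ω.op y⟫_ℂ := by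
  have h := LinearPMap.adjoint_isFormalAdjoint (T := ω.op) ω.selfAdjoint.dense_domain
  rw [LinearPMap.isSelfAdjoint_def.1 ω.selfAdjoint] at h
  exact h x y

/-- `⋂ₖ D(ω^k)`, as a type which does not carry the norm of `𝔥`. -/
def SmoothVec : Type _ := ω.smoothDomain

instance : AddCommGroup ω.SmoothVec := inferInstanceAs (AddCommGroup ω.smoothDomain)

instance : Module ℂ ω.SmoothVec := inferInstanceAs (Module ℂ ω.smoothDomain)

/-- The inclusion of `⋂ₖ D(ω^k)` in `D(ω)`. -/
def toDomain : ω.SmoothVec →ₗ[ℂ] ω.op.domain := Submodule.inclusion ω.smoothDomain_le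

/-- The scalar product `⟨x, ω y⟩` on `⋂ₖ D(ω^k)`. -/
@[reducible] def core : PreInnerProductSpace.Core ℂ ω.SmoothVec where
  inner x y := ⟪(ω.toDomain x : 𝔥), ω.op (ω.toDomain y)⟫_ℂ
  conj_inner_symm x y := by
    rw [inner_conj_symm]
    exact ω.symm _ _
  re_inner_nonneg x := ω.nonneg _
  add_left x y z := by simp
  smul_left x y r := by simp [mul_comm]

instance : SeminormedAddCommGroup ω.SmoothVec :=
  InnerProductSpace.Core.toSeminormedAddCommGroup (𝕜 := ℂ) (c := ω.core)

instance : InnerProductSpace ℂ ω.SmoothVec := InnerProductSpace.ofCore ω.core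

/-- The space `𝔥_ω`: the Hilbert completion of `⋂ₖ D(ω^k)` for the scalar product `⟨x, ω y⟩`. -/
abbrev FieldSpace : Type _ := UniformSpace.Completion ω.SmoothVec

instance : MeasurableSpace ω.FieldSpace := borel _

instance : BorelSpace ω.FieldSpace := ⟨rfl⟩

/-- The isometric extension `ω^{1/2} : 𝔥_ω → 𝔥`, where `σ` is the square root of `ω`. -/
def sqrtExt (σ : 𝔥 →ₗ.[ℂ] 𝔥) : ω.FieldSpace → 𝔥 :=
  UniformSpace.Completion.extension (fun x : ω.SmoothVec => applyOp σ (ω.toDomain x : 𝔥))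

/-- The pairing `⟨z, v⟩ = ⟨ω^{1/2} z, ω^{-1/2} v⟩` of `z ∈ 𝔥_ω` and `v ∈ D(ω^{-1/2})`. -/
def pairing (σ : 𝔥 →ₗ.[ℂ] 𝔥) (z : ω.FieldSpace) (v : 𝔥) : ℂ :=
  ⟪ω.sqrtExt σ z, applyOp σ.inverse v⟫_ℂ

end Dispersion

/-- `lam` and `ω^{-1/2} lam` belong to `L^∞(ℝ^d; 𝔥)`, where `σ` is the square root of `ω`. -/
structure IsFormFactor {d : ℕ} (σ : 𝔥 →ₗ.[ℂ] 𝔥) (lam : EuclideanSpace ℝ (Fin d) → 𝔥) : Prop where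
  memLp : MemLp lam ∞ volume
  mem_domain : ∀ᵐ x, lam x ∈ σ.inverse.domain
  memLp_inv : MemLp (fun x => applyOp σ.inverse (lam x)) ∞ volume

end Field

/-! ### The energies `⟨ψ, H_z ψ⟩` of the three models -/

section Nelson

variable {𝔥 : Type*} [NormedAddCommGroup 𝔥] [InnerProductSpace ℂ 𝔥] [CompleteSpace 𝔥]

/-- The Nelson potential `V_z(x) = 2 Re ⟨z, lam(x)⟩`. -/
def nelsonPotential (ω : Dispersion 𝔥) (σ : 𝔥 →ₗ.[ℂ] 𝔥) {d : ℕ}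
    (lam : EuclideanSpace ℝ (Fin d) → 𝔥) (z : ω.FieldSpace) (x : EuclideanSpace ℝ (Fin d)) : ℝ :=
  2 * (ω.pairing σ z (lam x)).re

open Classical in
/-- The Nelson energy, the quadratic form of
`H_z = ∑ⱼ (-Δⱼ + V_z(xⱼ)) + W + ⟨z, ω z⟩`; it is `+∞` outside of the form domain. -/
def nelsonEnergy (ω : Dispersion 𝔥) (σ : 𝔥 →ₗ.[ℂ] 𝔥) {d N : ℕ} (W : Config d N → ℝ)
    (lam : EuclideanSpace ℝ (Fin d) → 𝔥) (ψ : Wave d N) (z : ω.FieldSpace) : EReal :=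
  if FormDomain W ψ then
    ((freeForm W ψ + (∑ j, (∫ X, nelsonPotential ω σ lam z (pos j X) * ‖ψ X‖ ^ 2))
      + ‖z‖ ^ 2 * ‖ψ‖ ^ 2 : ℝ) : EReal)
  else ⊤

/-- The component `l` of the classical vector potential `a_{z}(x) = 2 Re ⟨z, lam(x)⟩`. -/
def vectorPotential (ω : Dispersion 𝔥) (σ : 𝔥 →ₗ.[ℂ] 𝔥)
    (lam : Fin 3 → EuclideanSpace ℝ (Fin 3) → 𝔥) (z : ω.FieldSpace) (l : Fin 3)
    (x : EuclideanSpace ℝ (Fin 3)) : ℝ :=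
  2 * (ω.pairing σ z (lam l x)).re

open Classical in
/-- The Pauli-Fierz energy, the quadratic form of
`H_z = ∑ⱼ (2 mⱼ)⁻¹ (-i∇ⱼ + e a_{z,j}(xⱼ))² + W + ⟨z, ω z⟩`; it is `+∞` outside of the form domain.
-/
def pauliFierzEnergy (ω : Dispersion 𝔥) (σ : 𝔥 →ₗ.[ℂ] 𝔥) {N : ℕ} (W : Config 3 N → ℝ)
    (m : Fin N → ℝ) (e : ℝ) (lam : Fin N → Fin 3 → EuclideanSpace ℝ (Fin 3) → 𝔥)
    (ψ : Wave 3 N) (z : ω.FieldSpace) : EReal :=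
  if FormDomain W ψ then
    (((∑ j, 1 / (2 * m j) * (∑ l, (∫ X,
        ‖-Complex.I * weakPartial (j, l) ψ X
          + ((e * vectorPotential ω σ (lam j) z l (pos j X) : ℝ) : ℂ) * ψ X‖ ^ 2)))
      + (∫ X, W X * ‖ψ X‖ ^ 2) + ‖z‖ ^ 2 * ‖ψ‖ ^ 2 : ℝ) : EReal)
  else ⊤

end Nelson

section Polaron

/-- The field space `L²(ℝ^d)` (in momentum space) of the polaron. -/
abbrev PolaronField (d : ℕ) : Type := Lp ℂ 2 (volume : Measure (EuclideanSpace ℝ (Fin d)))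

instance (d : ℕ) : MeasurableSpace (PolaronField d) := borel _

instance (d : ℕ) : BorelSpace (PolaronField d) := ⟨rfl⟩

/-- The low momentum part `V_<(x) = 2 Re ∫_{|k| ≤ r} conj z(k) |k|^{-(d-1)/2} e^{-ik·x} dk`. -/
def polaronLow {d : ℕ} (r : ℝ) (z : PolaronField d) (x : EuclideanSpace ℝ (Fin d)) : ℝ :=
  2 * (∫ k in {k : EuclideanSpace ℝ (Fin d) | ‖k‖ ≤ r},
    (starRingEnd ℂ) (z k) * ((‖k‖ ^ (-(((d : ℝ) - 1) / 2)) : ℝ) : ℂ)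
      * Complex.exp (-Complex.I * ((⟪k, x⟫_ℝ : ℝ) : ℂ))).re

/-- The component `l` of the bounded vector field
`G(x) = 2 Re ∫_{|k| > r} conj z(k) (i k / |k|) |k|^{-(d+1)/2} e^{-ik·x} dk`, whose divergence is
formally `2 Re ∫_{|k| > r} conj z(k) |k|^{-(d-1)/2} e^{-ik·x} dk`. -/
def polaronHigh {d : ℕ} (r : ℝ) (z : PolaronField d) (l : Fin d)
    (x : EuclideanSpace ℝ (Fin d)) : ℝ :=
  2 * (∫ k in {k : EuclideanSpace ℝ (Fin d) | r < ‖k‖},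
    (starRingEnd ℂ) (z k) * (Complex.I * ((k l / ‖k‖ : ℝ) : ℂ))
      * ((‖k‖ ^ (-(((d : ℝ) + 1) / 2)) : ℝ) : ℂ)
      * Complex.exp (-Complex.I * ((⟪k, x⟫_ℝ : ℝ) : ℂ))).re

open Classical in
/-- The polaron energy, the quadratic form of `H_z = ∑ⱼ (-Δⱼ + V_z(xⱼ)) + W + ‖z‖²` with
`V_z(x) = 2 √α Re ∫ conj z(k) |k|^{-(d-1)/2} e^{-ik·x} dk`, which is read as
`√α (V_< + [∇·, G])`, so that `⟨ψ, [∇ⱼ·, G(xⱼ)] ψ⟩ = -2 Re ∫ conj ψ G(xⱼ)·∇ⱼψ`. It is `+∞` outside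
of the form domain. -/
def polaronEnergy {d N : ℕ} (W : Config d N → ℝ) (α r : ℝ) (ψ : Wave d N)
    (z : PolaronField d) : EReal :=
  if FormDomain W ψ then
    ((freeForm W ψ
      + Real.sqrt α * (∑ j, ((∫ X, polaronLow r z (pos j X) * ‖ψ X‖ ^ 2)
          - 2 * (∑ l, (∫ X, (starRingEnd ℂ) (ψ X) * (polaronHigh r z l (pos j X) : ℂ)
              * weakPartial (j, l) ψ X).re)))
      + ‖z‖ ^ 2 * ‖ψ‖ ^ 2 : ℝ) : EReal)
  else ⊤

end Polaron

/-! ### State-valued measures -/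

section StateValued

variable {H : Type*} [NormedAddCommGroup H] [InnerProductSpace ℂ H] [CompleteSpace H]
variable {K : Type*} [MeasurableSpace K]

/-- The trace norm `‖T‖₁`, the supremum of `∑ᵢ |⟨fᵢ, T eᵢ⟩|` over finite orthonormal families; `T` is
trace class iff it is finite, and it is the trace of `T` if `T ≥ 0`. -/
def traceNorm (T : H →L[ℂ] H) : ℝ≥0∞ :=
  ⨆ (n : ℕ) (e : Fin n → H) (f : Fin n → H) (_ : Orthonormal ℂ e) (_ : Orthonormal ℂ f),
    ∑ i, ‖⟪f i, T (e i)⟫_ℂ‖ₑ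

/-- Normalized density matrices: nonnegative operators of trace one. -/
def IsDensityMatrix (γ : H →L[ℂ] H) : Prop := γ.IsPositive ∧ traceNorm γ = 1

/-- State-valued probability measures: measures on `K` with values in the nonnegative trace class
operators, `σ`-additive (unconditionally) in trace norm, of total trace one. -/
structure StateValuedMeasure (K H : Type*) [MeasurableSpace K] [NormedAddCommGroup H]
    [InnerProductSpace ℂ H] [CompleteSpace H] where
  toFun : Set K → H →L[ℂ] H
  positive : ∀ S, MeasurableSet S → (toFun S).IsPositive
  traceClass : ∀ S, MeasurableSet S → traceNorm (toFun S) < ∞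
  empty : toFun ∅ = 0
  additive : ∀ S : ℕ → Set K, (∀ n, MeasurableSet (S n)) → Pairwise (Function.onFun Disjoint S) →
    Tendsto (fun F : Finset ℕ => traceNorm (toFun (⋃ n, S n) - ∑ n ∈ F, toFun (S n)))
      atTop (𝓝 0)
  normalized : traceNorm (toFun univ) = 1

/-- The Radon-Nikodym decomposition `d𝔪(z) = γ(z) dμ(z)`, with `μ` a probability measure and `γ(z)`
normalized density matrices. -/
structure IsRadonNikodym (m : StateValuedMeasure K H) (μ : Measure K) (γ : K → H →L[ℂ] H) :
    Prop where
  prob : IsProbabilityMeasure μ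
  density : ∀ᵐ z ∂μ, IsDensityMatrix (γ z)
  measurable : ∀ φ χ : H, AEStronglyMeasurable (fun z => ⟪φ, γ z χ⟫_ℂ) μ
  eq_integral : ∀ S, MeasurableSet S → ∀ φ χ : H,
    ⟪φ, m.toFun S χ⟫_ℂ = ∫ z in S, ⟪φ, γ z χ⟫_ℂ ∂μ

/-- `γ = ∑ₖ wₖ |ψₖ⟩⟨ψₖ|` with `wₖ ≥ 0` and the `ψₖ` with `wₖ ≠ 0` orthonormal. -/
structure IsSpectralDecomposition (γ : H →L[ℂ] H) (w : ℕ → ℝ) (ψ : ℕ → H) : Prop where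
  nonneg : ∀ k, 0 ≤ w k
  orthonormal : Orthonormal ℂ (fun k : {k : ℕ // w k ≠ 0} => ψ k)
  hasSum : ∀ φ : H, HasSum (fun k => ((w k : ℂ) * ⟪ψ k, φ⟫_ℂ) • ψ k) (γ φ)

/-- A value in `ℝ ∪ {±∞}` is finite. -/
def IsFin (a : EReal) : Prop := a ≠ ⊥ ∧ a ≠ ⊤

open Classical in
/-- The integral of an extended real function, with value `+∞` if the function is not integrable.
The functions to which this is applied are bounded from below. -/
def extIntegral (μ : Measure K) (f : K → EReal) : EReal :=
  if (∀ᵐ z ∂μ, IsFin (f z)) ∧ Integrable (fun z => (f z).toReal) μ then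
    ((∫ z, (f z).toReal ∂μ : ℝ) : EReal)
  else ⊤

open Classical in
/-- The sum `∑ₖ wₖ f(k)`, with value `+∞` if it is not a convergent sum of finite terms. -/
def extSum (w : ℕ → ℝ) (f : ℕ → EReal) : EReal :=
  if (∀ k, w k ≠ 0 → IsFin (f k)) ∧ Summable (fun k => w k * (f k).toReal) then
    ((∑' k, w k * (f k).toReal : ℝ) : EReal)
  else ⊤

open Classical in
/-- `tr[γ A]` for a density matrix `γ` and a quadratic form `q(ψ) = ⟨ψ, A ψ⟩` bounded from below:
`∑ₖ wₖ q(ψₖ)` if `γ = ∑ₖ wₖ |ψₖ⟩⟨ψₖ|` is a spectral decomposition. The value does not depend on the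
one which is chosen. -/
def traceForm (q : H → EReal) (γ : H →L[ℂ] H) : EReal :=
  if h : ∃ p : (ℕ → ℝ) × (ℕ → H), IsSpectralDecomposition γ p.1 p.2 then
    extSum h.choose.1 (fun k => q (h.choose.2 k))
  else ⊤

/-! ### The variational problems, for an energy `E ψ z = ⟨ψ, H_z ψ⟩` -/

/-- `a` belongs to the domain `D` and minimizes `F` there. -/
def IsMinimizer {α : Type*} (D : Set α) (F : α → EReal) (a : α) : Prop :=
  a ∈ D ∧ F a = ⨅ b ∈ D, F b

/-- `(ψ, z)` minimizes the quasi-classical energy. -/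
def IsQcMinimizer (E : H → K → EReal) (p : H × K) : Prop :=
  IsMinimizer {p : H × K | ‖p.1‖ = 1 ∧ IsFin (E p.1 p.2)} (fun p => E p.1 p.2) p

/-- `ψ` minimizes the Pekar functional `P`. -/
def IsPekarMinimizer (P : H → EReal) (ψ : H) : Prop :=
  IsMinimizer {ψ : H | ‖ψ‖ = 1 ∧ IsFin (P ψ)} P ψ

open Classical in
/-- The energy `∫ dμ(z) tr[γ(z) H_z]` of the state-valued measure `d𝔪(z) = γ(z) dμ(z)`. The
Radon-Nikodym decomposition is unique up to null sets. -/
def svmEnergy (E : H → K → EReal) (m : StateValuedMeasure K H) : EReal :=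
  if h : ∃ p : Measure K × (K → H →L[ℂ] H), IsRadonNikodym m p.1 p.2 then
    extIntegral h.choose.1 (fun z => traceForm (fun ψ => E ψ z) (h.choose.2 z))
  else ⊤

/-- `𝔪` minimizes the energy of state-valued measures. -/
def IsSvmMinimizer (E : H → K → EReal) (m : StateValuedMeasure K H) : Prop :=
  IsMinimizer {m | IsFin (svmEnergy E m)} (svmEnergy E) m

/-- The energy `∫ dμ(z) ⟨ψ, H_z ψ⟩` of a product of a wave function and a measure. -/
def pmEnergy (E : H → K → EReal) (p : H × Measure K) : EReal := extIntegral p.2 (E p.1)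

/-- `(ψ, μ)` minimizes the energy of product measures. -/
def IsPmMinimizer (E : H → K → EReal) (p : H × Measure K) : Prop :=
  IsMinimizer {p : H × Measure K | ‖p.1‖ = 1 ∧ IsProbabilityMeasure p.2 ∧ IsFin (pmEnergy E p)}
    (pmEnergy E) p

/-- `d𝔪(z) = γ(z) dμ(z)` is concentrated on the minimizers of the quasi-classical energy: for
`μ`-almost every `z`, all the normalized eigenvectors `ψ` of `γ(z)` with nonzero eigenvalue, i.e. all
the pure states of which `γ(z)` is a mixture, are such that `(ψ, z)` is a minimizer. -/
def IsConcentratedOnMinimizers (E : H → K → EReal) (m : StateValuedMeasure K H) : Prop :=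
  (∃ (μ : Measure K) (γ : K → H →L[ℂ] H), IsRadonNikodym m μ γ) ∧
  ∀ (μ : Measure K) (γ : K → H →L[ℂ] H), IsRadonNikodym m μ γ →
    ∀ᵐ z ∂μ, ∀ (ψ : H) (c : ℂ), ‖ψ‖ = 1 → c ≠ 0 → γ z ψ = c • ψ → IsQcMinimizer E (ψ, z)

/-- The Pekar functional obtained by minimizing over the field. -/
def pekarInf (E : H → K → EReal) (ψ : H) : EReal := ⨅ z, E ψ z

/-- `z` is a critical point of the energy of `ψ` as a function of the field. -/
def IsCriticalField {K : Type*} [AddCommGroup K] [Module ℂ K] (E : H → K → EReal) (ψ : H) (z : K) :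
    Prop :=
  IsFin (E ψ z) ∧ ∀ v : K, HasDerivAt (fun t : ℝ => (E ψ (z + (t : ℂ) • v)).toReal) 0 0

open Classical in
/-- The Pekar functional `E[ψ, z_ψ]`, where `z_ψ` is the critical point of `z ↦ E[ψ, z]`. -/
def pekarCritical {K : Type*} [AddCommGroup K] [Module ℂ K] (E : H → K → EReal) (ψ : H) : EReal :=
  if h : ∃ z, IsCriticalField E ψ z then E ψ h.choose else ⊤

end StateValued

end QuasiClassical

end

/-!
Each of the four functionals has a minimizer as soon as one of them does because their values
dominate each other: a pair `(ψ, z)` is at the same time a pure state at a point mass and a product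
of `ψ` with a point mass, while conversely an energy which is an average, over the measure of the
field and over the eigenvectors of the density matrices, attains somewhere a value which is at most
its mean. For a fixed `ψ` the energy is a convex quadratic function of the field to which the field
energy `‖z‖²` is added; it is therefore coercive, and by the Lax-Milgram theorem its infimum is
attained, exactly at the critical points.

At a minimizing state-valued measure the average equals its lower bound, hence the energies of
almost all states in the mixture are equal to the minimum `e`. For fixed `z` the vectors `ψ` with
`⟨ψ, H_z ψ⟩ = e ‖ψ‖²` are the null space of a nonnegative quadratic form, so they form a linear
subspace, and every eigenvector of the density matrix with a nonzero eigenvalue is a finite linear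
combination of vectors of the mixture.
-/

noncomputable section

namespace QuasiClassical

/-! ### Density matrices and their spectral decompositions -/

section Trace

variable {H : Type*} [NormedAddCommGroup H] [InnerProductSpace ℂ H]

theorem countable_of_orthonormal [TopologicalSpace.SeparableSpace H] {ι : Type*} {v : ι → H}
    (hv : Orthonormal ℂ v) : Countable ι := by
  refine Pairwise.countable_of_isOpen_disjoint (s := fun i => Metric.ball (v i) (1 / 2))
    (fun i j hij => Metric.ball_disjoint_ball ?_) (fun _ => Metric.isOpen_ball)
    (fun i => ⟨v i, Metric.mem_ball_self one_half_pos⟩)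
  have hsq : ‖v i - v j‖ ^ 2 = 2 := by
    rw [norm_sub_sq (𝕜 := ℂ), hv.1 i, hv.1 j, hv.2 hij]
    norm_num
  rw [dist_eq_norm]
  nlinarith [norm_nonneg (v i - v j)]

theorem tsum_enorm_inner_sq {ι : Type*} (b : HilbertBasis ι ℂ H) (x : H) :
    ∑' i, ‖⟪b i, x⟫_ℂ‖ₑ ^ 2 = ‖x‖ₑ ^ 2 := by
  have hsum : HasSum (fun i => ‖⟪b i, x⟫_ℂ‖ ^ 2) (‖x‖ ^ 2) := by
    simpa [b.repr_apply_apply] using lp.hasSum_norm (p := 2) (by norm_num) (b.repr x)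
  simp_rw [← ofReal_norm, ← ENNReal.ofReal_pow (norm_nonneg _)]
  rw [← hsum.tsum_eq, ENNReal.ofReal_tsum_of_nonneg (fun _ => by positivity) hsum.summable]

theorem sum_enorm_inner_le_traceNorm (T : H →L[ℂ] H) {ι : Type*} [Fintype ι] {e f : ι → H}
    (he : Orthonormal ℂ e) (hf : Orthonormal ℂ f) :
    ∑ i, ‖⟪f i, T (e i)⟫_ℂ‖ₑ ≤ traceNorm T := by
  let n := (Fintype.equivFin ι).symm
  rw [← n.sum_comp]
  exact le_iSup_of_le _ <| le_iSup_of_le (e ∘ n) <| le_iSup_of_le (f ∘ n) <|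
    le_iSup_of_le (he.comp n n.injective) <| le_iSup_of_le (hf.comp n n.injective) le_rfl

theorem norm_inner_le_of_traceNorm_le_one {γ : H →L[ℂ] H} (hγ : traceNorm γ ≤ 1) (φ χ : H) :
    ‖⟪φ, γ χ⟫_ℂ‖ ≤ ‖φ‖ * ‖χ‖ := by
  rcases eq_or_ne φ 0 with rfl | hφ
  · simp
  rcases eq_or_ne χ 0 with rfl | hχ
  · simp
  have hunit {x : H} (hx : x ≠ 0) : Orthonormal ℂ fun _ : Unit => ((‖x‖⁻¹ : ℝ) : ℂ) • x :=
    ⟨fun _ => by simpa using norm_smul_inv_norm (𝕜 := ℂ) hx,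
      fun i j hij => absurd (Subsingleton.elim i j) hij⟩
  have h := (sum_enorm_inner_le_traceNorm γ (hunit hχ) (hunit hφ)).trans hγ
  rw [Fintype.sum_unique, map_smul, inner_smul_left, inner_smul_right, ← ofReal_norm,
    ENNReal.ofReal_le_one] at h
  simp only [Complex.conj_ofReal, norm_mul, Complex.norm_real, norm_inv, norm_norm] at h
  have := norm_pos_iff.2 hφ
  have := norm_pos_iff.2 hχ
  field_simp at h
  linarith

variable {γ : H →L[ℂ] H} {w : ℕ → ℝ} {ψ : ℕ → H}

namespace IsSpectralDecomposition

theorem weight_mul_inner (h : IsSpectralDecomposition γ w ψ) (j : ℕ) {k : ℕ} (hk : w k ≠ 0) :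
    (w j : ℂ) * ⟪ψ j, ψ k⟫_ℂ = if j = k then (w k : ℂ) else 0 := by
  split_ifs with hjk
  · subst hjk
    simp [inner_self_eq_norm_sq_to_K, h.orthonormal.1 ⟨j, hk⟩]
  · by_cases hj : w j = 0
    · simp [hj]
    · rw [h.orthonormal.2 (i := ⟨j, hj⟩) (j := ⟨k, hk⟩) (by simpa using hjk), mul_zero]

theorem apply_eigenvector (h : IsSpectralDecomposition γ w ψ) {k : ℕ} (hk : w k ≠ 0) :
    γ (ψ k) = (w k : ℂ) • ψ k := by
  refine (h.hasSum (ψ k)).unique ?_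
  convert hasSum_single k fun j hj => ?_ using 1
  · rw [h.weight_mul_inner k hk, if_pos rfl]
  · rw [h.weight_mul_inner j hk, if_neg hj, zero_smul]

theorem inner_apply (h : IsSpectralDecomposition γ w ψ) {k : ℕ} (hk : w k ≠ 0) (φ : H) :
    ⟪ψ k, γ φ⟫_ℂ = w k * ⟪ψ k, φ⟫_ℂ := by
  have hterm (j : ℕ) : ⟪ψ k, ((w j : ℂ) * ⟪ψ j, φ⟫_ℂ) • ψ j⟫_ℂ
      = if j = k then (w k : ℂ) * ⟪ψ k, φ⟫_ℂ else 0 := by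
    have hconj := congrArg (starRingEnd ℂ) (h.weight_mul_inner j hk)
    rw [map_mul, Complex.conj_ofReal, inner_conj_symm] at hconj
    rw [inner_smul_right, mul_right_comm, hconj]
    split_ifs with hjk <;> simp [hjk]
  have hsum := (h.hasSum φ).mapL (innerSL ℂ (ψ k))
  simp only [innerSL_apply_apply, hterm] at hsum
  exact hsum.unique (hasSum_ite_eq k _)

theorem inner_eq_zero (h : IsSpectralDecomposition γ w ψ) {k : ℕ} (hk : w k ≠ 0) {φ : H} {c : ℂ}
    (hφ : γ φ = c • φ) (hkc : (w k : ℂ) ≠ c) : ⟪ψ k, φ⟫_ℂ = 0 := by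
  have hmul := h.inner_apply hk φ
  rw [hφ, inner_smul_right, mul_eq_mul_right_iff] at hmul
  exact hmul.resolve_left hkc.symm

theorem mem_span_of_eigenvector (h : IsSpectralDecomposition γ w ψ) (hw : Summable w) {φ : H}
    {c : ℂ} (hc : c ≠ 0) (hφ : γ φ = c • φ) : φ ∈ Submodule.span ℂ (ψ '' {k | w k ≠ 0}) := by
  have hfinite : {k | (w k : ℂ) = c}.Finite := by
    have hsmall : ∀ᶠ k in cofinite, (w k : ℂ) ≠ c :=
      ((Complex.continuous_ofReal.tendsto' 0 0 rfl).comp hw.tendsto_cofinite_zero).eventually_ne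
        hc.symm
    simpa [eventually_cofinite] using hsmall
  have hvanish (k : ℕ) (hk : k ∉ hfinite.toFinset) : ((w k : ℂ) * ⟪ψ k, φ⟫_ℂ) • ψ k = 0 := by
    by_cases hwk : w k = 0
    · simp [hwk]
    · simp [h.inner_eq_zero hwk hφ (by simpa using hk)]
  refine (Submodule.smul_mem_iff _ hc).1 ?_
  rw [← hφ, (h.hasSum φ).unique (hasSum_sum_of_ne_finset_zero hvanish)]
  refine Submodule.sum_mem _ fun k hk => Submodule.smul_mem _ _ (Submodule.subset_span ⟨k, ?_, rfl⟩)
  rw [Finite.mem_toFinset] at hk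
  intro hwk
  exact hc (by simpa [hwk] using hk.symm)

end IsSpectralDecomposition

theorem isSpectralDecomposition_rankOne {φ : H} (hφ : ‖φ‖ = 1) :
    IsSpectralDecomposition (InnerProductSpace.rankOne ℂ φ φ) (Pi.single 0 1) (fun _ => φ) where
  nonneg k := by by_cases hk : k = 0 <;> simp [hk]
  orthonormal := by
    have hzero (i : {k : ℕ // (Pi.single 0 1 : ℕ → ℝ) k ≠ 0}) : (i : ℕ) = 0 := by
      by_contra hi
      exact i.2 (by simp [hi])
    exact ⟨fun _ => hφ, fun i j hij => absurd (Subtype.ext ((hzero i).trans (hzero j).symm)) hij⟩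
  hasSum χ := by
    convert hasSum_single 0 fun k hk => ?_ using 1
    · simp
    · simp [hk]

variable [CompleteSpace H]

open ContinuousLinearMap in
theorem sum_enorm_apply_sq_le {ι κ : Type*} [Fintype κ] (b : HilbertBasis ι ℂ H) (A : H →L[ℂ] H)
    {e : κ → H} (he : Orthonormal ℂ e) :
    ∑ j, ‖A (e j)‖ₑ ^ 2 ≤ ∑' i, ‖adjoint A (b i)‖ₑ ^ 2 := by
  have hbessel (x : H) : ∑ j, ‖⟪e j, x⟫_ℂ‖ₑ ^ 2 ≤ ‖x‖ₑ ^ 2 := by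
    simp_rw [← ofReal_norm, ← ENNReal.ofReal_pow (norm_nonneg _)]
    rw [← ENNReal.ofReal_sum_of_nonneg fun _ _ => by positivity]
    exact ENNReal.ofReal_le_ofReal (he.sum_inner_products_le x)
  calc ∑ j, ‖A (e j)‖ₑ ^ 2
      = ∑ j, ∑' i, ‖⟪e j, adjoint A (b i)⟫_ℂ‖ₑ ^ 2 := by
        refine Finset.sum_congr rfl fun j _ => ?_
        rw [← tsum_enorm_inner_sq b]
        refine tsum_congr fun i => ?_
        rw [adjoint_inner_right, ← ofReal_norm, ← ofReal_norm, norm_inner_symm]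
    _ = ∑' i, ∑ j, ‖⟪e j, adjoint A (b i)⟫_ℂ‖ₑ ^ 2 :=
        (Summable.tsum_finsetSum fun _ _ => ENNReal.summable).symm
    _ ≤ ∑' i, ‖adjoint A (b i)‖ₑ ^ 2 := ENNReal.tsum_le_tsum fun i => hbessel _

theorem exists_isSelfAdjoint_inner_apply_eq (hγ : γ.IsPositive) :
    ∃ A : H →L[ℂ] H, IsSelfAdjoint A ∧ ∀ x y, ⟪x, γ y⟫_ℂ = ⟪A x, A y⟫_ℂ := by
  have hA : IsSelfAdjoint (CFC.sqrt γ) := (CFC.sqrt_nonneg γ).isSelfAdjoint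
  refine ⟨CFC.sqrt γ, hA, fun x y => ?_⟩
  conv_lhs => rw [← CFC.sqrt_mul_sqrt_self γ ((ContinuousLinearMap.nonneg_iff_isPositive γ).2 hγ)]
  exact (hA.isSymmetric _ _).symm

theorem traceNorm_le_tsum_diagonal {ι : Type*} (b : HilbertBasis ι ℂ H) (hγ : γ.IsPositive) :
    traceNorm γ ≤ ∑' i, ENNReal.ofReal (⟪b i, γ (b i)⟫_ℂ).re := by
  obtain ⟨A, hA, hAγ⟩ := exists_isSelfAdjoint_inner_apply_eq hγ
  have hdiag (x : H) : ENNReal.ofReal (⟪x, γ x⟫_ℂ).re = ‖A x‖ₑ ^ 2 := by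
    rw [hAγ, ← ofReal_norm, ← ENNReal.ofReal_pow (norm_nonneg _), norm_sq_eq_re_inner (𝕜 := ℂ)]
    rfl
  have hbound {n : ℕ} {e : Fin n → H} (he : Orthonormal ℂ e) :
      ∑ i, ‖A (e i)‖ₑ ^ 2 ≤ ∑' i, ‖A (b i)‖ₑ ^ 2 := by
    simpa only [hA.adjoint_eq] using sum_enorm_apply_sq_le b A he
  simp_rw [hdiag]
  refine iSup_le fun n => iSup_le fun e => iSup_le fun f => iSup_le fun he => iSup_le fun hf => ?_
  calc ∑ i, ‖⟪f i, γ (e i)⟫_ℂ‖ₑ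
      ≤ ∑ i, ‖A (f i)‖ₑ * ‖A (e i)‖ₑ := by
        refine Finset.sum_le_sum fun i _ => ?_
        simp_rw [hAγ, ← ofReal_norm, ← ENNReal.ofReal_mul (norm_nonneg _)]
        exact ENNReal.ofReal_le_ofReal (norm_inner_le_norm _ _)
    _ ≤ (∑ i, ‖A (f i)‖ₑ ^ 2) ^ (1 / 2 : ℝ) * (∑ i, ‖A (e i)‖ₑ ^ 2) ^ (1 / 2 : ℝ) := by
        exact_mod_cast ENNReal.inner_le_Lp_mul_Lq Finset.univ _ _ Real.HolderConjugate.two_two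
    _ ≤ (∑' i, ‖A (b i)‖ₑ ^ 2) ^ (1 / 2 : ℝ) * (∑' i, ‖A (b i)‖ₑ ^ 2) ^ (1 / 2 : ℝ) := by
        gcongr
        exacts [hbound hf, hbound he]
    _ = ∑' i, ‖A (b i)‖ₑ ^ 2 := by
        rw [← ENNReal.rpow_add_of_nonneg _ _ (by norm_num) (by norm_num)]
        norm_num

theorem traceNorm_eq_tsum_diagonal {ι : Type*} (b : HilbertBasis ι ℂ H) (hγ : γ.IsPositive) :
    traceNorm γ = ∑' i, ENNReal.ofReal (⟪b i, γ (b i)⟫_ℂ).re := by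
  refine (traceNorm_le_tsum_diagonal b hγ).antisymm (ENNReal.summable.tsum_le_of_sum_le fun s => ?_)
  have hs : Orthonormal ℂ fun i : s => b i := b.orthonormal.comp _ Subtype.val_injective
  refine le_trans ?_ (sum_enorm_inner_le_traceNorm γ hs hs)
  rw [← Finset.sum_coe_sort]
  refine Finset.sum_le_sum fun i _ => ?_
  rw [← ofReal_norm]
  exact ENNReal.ofReal_le_ofReal (Complex.re_le_norm _)

theorem IsSpectralDecomposition.tsum_weight (h : IsSpectralDecomposition γ w ψ)
    (hγ : γ.IsPositive) : ∑' k, ENNReal.ofReal (w k) = traceNorm γ := by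
  obtain ⟨s, b, -⟩ := exists_hilbertBasis ℂ H
  have hdiag (i : s) : ENNReal.ofReal (⟪b i, γ (b i)⟫_ℂ).re
      = ∑' k, ENNReal.ofReal (w k) * ‖⟪b i, ψ k⟫_ℂ‖ₑ ^ 2 := by
    have hsum : HasSum (fun k => w k * ‖⟪b i, ψ k⟫_ℂ‖ ^ 2) (⟪b i, γ (b i)⟫_ℂ).re := by
      convert Complex.hasSum_re ((h.hasSum (b i)).mapL (innerSL ℂ (b i))) using 2 with k
      · rw [innerSL_apply_apply, inner_smul_right, mul_assoc, Complex.re_ofReal_mul,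
          ← RCLike.re_eq_complex_re, inner_mul_symm_re_eq_norm, norm_mul, norm_inner_symm (ψ k),
          ← sq]
      · rw [innerSL_apply_apply]
    rw [← hsum.tsum_eq, ENNReal.ofReal_tsum_of_nonneg
      (fun k => mul_nonneg (h.nonneg k) (sq_nonneg _)) hsum.summable]
    refine tsum_congr fun k => ?_
    rw [ENNReal.ofReal_mul (h.nonneg k), ENNReal.ofReal_pow (norm_nonneg _), ofReal_norm]
  simp_rw [traceNorm_eq_tsum_diagonal b hγ, hdiag]
  rw [ENNReal.tsum_comm]
  refine tsum_congr fun k => ?_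
  rw [ENNReal.tsum_mul_left, tsum_enorm_inner_sq b]
  by_cases hk : w k = 0
  · simp [hk]
  · simp [← ofReal_norm, h.orthonormal.1 ⟨k, hk⟩]

theorem IsSpectralDecomposition.hasSum_weight (h : IsSpectralDecomposition γ w ψ)
    (hγ : IsDensityMatrix γ) : HasSum w 1 := by
  have htsum : ∑' k, ENNReal.ofReal (w k) = 1 := (h.tsum_weight hγ.1).trans hγ.2
  have := ENNReal.hasSum_toReal (f := fun k => ENNReal.ofReal (w k)) (by simp [htsum])
  rw [← ENNReal.tsum_toReal_eq fun _ => ENNReal.ofReal_ne_top, htsum] at this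
  simpa [ENNReal.toReal_ofReal (h.nonneg _)] using this

theorem isDensityMatrix_rankOne {φ : H} (hφ : ‖φ‖ = 1) :
    IsDensityMatrix (InnerProductSpace.rankOne ℂ φ φ) := by
  have hpos := InnerProductSpace.isPositive_rankOne_self (𝕜 := ℂ) φ
  refine ⟨hpos, ?_⟩
  rw [← (isSpectralDecomposition_rankOne hφ).tsum_weight hpos, tsum_eq_single 0] <;>
    simp +contextual

end Trace

/-! ### Uniqueness of the Radon-Nikodym decomposition -/

section RadonNikodym

variable {H : Type*} [NormedAddCommGroup H] [InnerProductSpace ℂ H] [CompleteSpace H]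
variable {K : Type*} [MeasurableSpace K]
variable {m : StateValuedMeasure K H} {μ μ' : Measure K} {γ γ' : K → H →L[ℂ] H}

namespace IsRadonNikodym

theorem integrable_inner (h : IsRadonNikodym m μ γ) (φ χ : H) :
    Integrable (fun z => ⟪φ, γ z χ⟫_ℂ) μ := by
  have := h.prob
  exact .of_bound (h.measurable φ χ) (‖φ‖ * ‖χ‖)
    (h.density.mono fun z hz => norm_inner_le_of_traceNorm_le_one hz.2.le φ χ)

theorem measure_apply {ι : Type*} [Countable ι] (b : HilbertBasis ι ℂ H)
    (h : IsRadonNikodym m μ γ) {S : Set K} (hS : MeasurableSet S) :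
    μ S = ∑' i, ENNReal.ofReal (⟪b i, m.toFun S (b i)⟫_ℂ).re := by
  have hint (i : ι) : Integrable (fun z => (⟪b i, γ z (b i)⟫_ℂ).re) (μ.restrict S) :=
    (h.integrable_inner (b i) (b i)).re.restrict
  calc μ S = ∫⁻ z in S, ∑' i, ENNReal.ofReal (⟪b i, γ z (b i)⟫_ℂ).re ∂μ := by
        rw [← setLIntegral_one]
        refine lintegral_congr_ae (ae_restrict_of_ae (h.density.mono fun z hz => ?_))
        rw [← hz.2, traceNorm_eq_tsum_diagonal b hz.1]
    _ = ∑' i, ∫⁻ z in S, ENNReal.ofReal (⟪b i, γ z (b i)⟫_ℂ).re ∂μ :=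
        lintegral_tsum fun i => (hint i).aestronglyMeasurable.aemeasurable.ennreal_ofReal
    _ = ∑' i, ENNReal.ofReal (⟪b i, m.toFun S (b i)⟫_ℂ).re := by
        refine tsum_congr fun i => ?_
        rw [← ofReal_integral_eq_lintegral_ofReal (hint i)
          (ae_restrict_of_ae (h.density.mono fun z hz => hz.1.re_inner_nonneg_right (b i))),
          h.eq_integral S hS]
        exact congrArg _ (integral_re (h.integrable_inner (b i) (b i)).restrict)

variable [TopologicalSpace.SeparableSpace H]

theorem measure_eq (h : IsRadonNikodym m μ γ) (h' : IsRadonNikodym m μ' γ') : μ = μ' := by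
  obtain ⟨s, b, -⟩ := exists_hilbertBasis ℂ H
  have := countable_of_orthonormal b.orthonormal
  exact Measure.ext fun S hS => by rw [h.measure_apply b hS, h'.measure_apply b hS]

theorem density_ae_eq (h : IsRadonNikodym m μ γ) (h' : IsRadonNikodym m μ γ') : γ =ᵐ[μ] γ' := by
  have hentry (φ χ : H) : ∀ᵐ z ∂μ, ⟪φ, γ z χ⟫_ℂ = ⟪φ, γ' z χ⟫_ℂ :=
    Integrable.ae_eq_of_forall_setIntegral_eq _ _ (h.integrable_inner φ χ)
      (h'.integrable_inner φ χ) fun S hS _ => by rw [← h.eq_integral S hS, ← h'.eq_integral S hS]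
  let u := TopologicalSpace.denseSeq H
  have hu : DenseRange u := TopologicalSpace.denseRange_denseSeq H
  have hdense : ∀ᵐ z ∂μ, ∀ i j, ⟪u i, γ z (u j)⟫_ℂ = ⟪u i, γ' z (u j)⟫_ℂ :=
    ae_all_iff.2 fun i => ae_all_iff.2 fun j => hentry _ _
  filter_upwards [hdense] with z hz
  refine ContinuousLinearMap.coeFn_injective ?_
  refine hu.equalizer (γ z).continuous (γ' z).continuous (funext fun j => ext_inner_left ℂ ?_)
  exact congrFun (hu.equalizer (by fun_prop) (by fun_prop) (funext fun i => hz i j))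

end IsRadonNikodym

end RadonNikodym

/-! ### Averages -/

section Averages

variable {K : Type*} [MeasurableSpace K]

theorem IsFin.coe_toReal {a : EReal} (h : IsFin a) : (a.toReal : EReal) = a :=
  EReal.coe_toReal h.2 h.1

theorem isFin_coe (r : ℝ) : IsFin (r : EReal) := ⟨EReal.coe_ne_bot r, EReal.coe_ne_top r⟩

theorem IsFin.toReal_le_toReal {a b : EReal} (ha : IsFin a) (hb : IsFin b) (h : a ≤ b) :
    a.toReal ≤ b.toReal :=
  EReal.toReal_le_toReal h ha.1 hb.2

theorem isFin_extIntegral_iff {μ : Measure K} {f : K → EReal} :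
    IsFin (extIntegral μ f) ↔ (∀ᵐ z ∂μ, IsFin (f z)) ∧ Integrable (fun z => (f z).toReal) μ := by
  unfold extIntegral
  split_ifs with h
  · exact iff_of_true (isFin_coe _) h
  · exact iff_of_false (fun hf => hf.2 rfl) h

theorem isFin_extSum_iff {w : ℕ → ℝ} {f : ℕ → EReal} :
    IsFin (extSum w f) ↔
      (∀ k, w k ≠ 0 → IsFin (f k)) ∧ Summable (fun k => w k * (f k).toReal) := by
  unfold extSum
  split_ifs with h
  · exact iff_of_true (isFin_coe _) h
  · exact iff_of_false (fun hf => hf.2 rfl) h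

theorem exists_le_extIntegral {μ : Measure K} [IsProbabilityMeasure μ] {f : K → EReal}
    {p : K → Prop} (hp : ∀ᵐ z ∂μ, p z) (hf : IsFin (extIntegral μ f)) :
    ∃ z, p z ∧ IsFin (f z) ∧ f z ≤ extIntegral μ f := by
  have hfin := isFin_extIntegral_iff.1 hf
  obtain ⟨z, hz, hle⟩ := exists_notMem_null_le_integral hfin.2 (ae_iff.1 (hp.and hfin.1))
  obtain ⟨hpz, hfz⟩ := not_not.1 hz
  refine ⟨z, hpz, hfz, ?_⟩
  rw [extIntegral, if_pos hfin, ← hfz.coe_toReal]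
  exact EReal.coe_le_coe_iff.2 hle

theorem ae_eq_of_extIntegral_eq {μ : Measure K} [IsProbabilityMeasure μ] {f : K → EReal} {e : ℝ}
    (hle : ∀ᵐ z ∂μ, IsFin (f z) → (e : EReal) ≤ f z) (he : extIntegral μ f = e) :
    ∀ᵐ z ∂μ, f z = e := by
  have hfin := isFin_extIntegral_iff.1 (he ▸ isFin_coe e)
  rw [extIntegral, if_pos hfin, EReal.coe_eq_coe_iff] at he
  have hle' : (fun _ => e) ≤ᵐ[μ] fun z => (f z).toReal := by
    filter_upwards [hle, hfin.1] with z hz hfz using (isFin_coe e).toReal_le_toReal hfz (hz hfz)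
  have heq := (integral_eq_iff_of_ae_le (integrable_const e) hfin.2 hle').1 (by simp [he])
  filter_upwards [heq, hfin.1] with z hz hfz
  rw [← hfz.coe_toReal, ← hz]

theorem extIntegral_dirac [MeasurableSingletonClass K] {f : K → EReal} {z : K}
    (hf : IsFin (f z)) : extIntegral (Measure.dirac z) f = f z := by
  have hfin : IsFin (extIntegral (Measure.dirac z) f) :=
    isFin_extIntegral_iff.2 ⟨by simpa [ae_dirac_eq] using hf,
      (integrable_const (f z).toReal).congr (by simp [EventuallyEq, ae_dirac_eq])⟩
  rw [extIntegral, if_pos (isFin_extIntegral_iff.1 hfin), integral_dirac, hf.coe_toReal]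

variable {w : ℕ → ℝ} {f : ℕ → EReal}

theorem exists_le_extSum (hw : ∀ k, 0 ≤ w k) (hw1 : HasSum w 1) (hf : IsFin (extSum w f)) :
    ∃ k, w k ≠ 0 ∧ IsFin (f k) ∧ f k ≤ extSum w f := by
  have hfin := isFin_extSum_iff.1 hf
  set e := ∑' k, w k * (f k).toReal with he
  have hsum : extSum w f = e := by rw [extSum, if_pos hfin]
  by_contra! hlt
  have hlt' (k : ℕ) (hk : w k ≠ 0) : e < (f k).toReal := by
    have := hlt k hk (hfin.1 k hk)
    rwa [hsum, ← (hfin.1 k hk).coe_toReal, EReal.coe_lt_coe_iff] at this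
  obtain ⟨k, hk⟩ : ∃ k, w k ≠ 0 := by
    by_contra! h0
    exact zero_ne_one (hasSum_zero.unique (funext h0 ▸ hw1))
  have hmean : HasSum (fun k => w k * e) e := by simpa using hw1.mul_right e
  refine (hasSum_lt (i := k) (fun j => ?_) ?_ hmean hfin.2.hasSum).ne he
  · rcases eq_or_ne (w j) 0 with hj | hj
    · simp [hj]
    · exact mul_le_mul_of_nonneg_left (hlt' j hj).le (hw j)
  · exact mul_lt_mul_of_pos_left (hlt' k hk) ((hw k).lt_of_ne' hk)

theorem eq_of_extSum_eq (hw : ∀ k, 0 ≤ w k) (hw1 : HasSum w 1) {e : ℝ}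
    (hle : ∀ k, w k ≠ 0 → IsFin (f k) → (e : EReal) ≤ f k) (he : extSum w f = e) {k : ℕ}
    (hk : w k ≠ 0) : f k = e := by
  have hfin := isFin_extSum_iff.1 (he ▸ isFin_coe e)
  rw [extSum, if_pos hfin, EReal.coe_eq_coe_iff] at he
  have hgap : HasSum (fun k => w k * ((f k).toReal - e)) 0 := by
    simpa [mul_sub, he] using hfin.2.hasSum.sub (hw1.mul_right e)
  have hnonneg : 0 ≤ fun k => w k * ((f k).toReal - e) := fun j => by
    rcases eq_or_ne (w j) 0 with hj | hj
    · simp [hj]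
    · have hfj := hfin.1 j hj
      exact mul_nonneg (hw j)
        (sub_nonneg.2 ((isFin_coe e).toReal_le_toReal hfj (hle j hj hfj)))
  have hzero := congrFun ((hasSum_zero_iff_of_nonneg hnonneg).1 hgap) k
  rw [← (hfin.1 k hk).coe_toReal, sub_eq_zero.1 ((mul_eq_zero.1 hzero).resolve_left hk)]

theorem extSum_eq_of_forall_eq (hw1 : HasSum w 1) {e : ℝ} (h : ∀ k, w k ≠ 0 → f k = e) :
    extSum w f = e := by
  have hterm (k : ℕ) : w k * (f k).toReal = w k * e := by
    rcases eq_or_ne (w k) 0 with hk | hk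
    · simp [hk]
    · rw [h k hk, EReal.toReal_coe]
  have hsum : HasSum (fun k => w k * (f k).toReal) e := by
    simpa [hterm] using hw1.mul_right e
  rw [extSum, if_pos ⟨fun k hk => h k hk ▸ isFin_coe e, hsum.summable⟩, hsum.tsum_eq]

variable {H : Type*} [NormedAddCommGroup H] [InnerProductSpace ℂ H]
variable {γ : H →L[ℂ] H} {q : H → EReal}

theorem exists_traceForm_eq_extSum (h : IsFin (traceForm q γ)) :
    ∃ w ψ, IsSpectralDecomposition γ w ψ ∧ traceForm q γ = extSum w fun k => q (ψ k) := by
  unfold traceForm at h ⊢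
  split_ifs at h ⊢ with hdec
  · exact ⟨_, _, hdec.choose_spec, rfl⟩
  · exact absurd rfl h.2

variable [CompleteSpace H]

theorem exists_le_traceForm (hγ : IsDensityMatrix γ) (h : IsFin (traceForm q γ)) :
    ∃ ψ, ‖ψ‖ = 1 ∧ IsFin (q ψ) ∧ q ψ ≤ traceForm q γ := by
  obtain ⟨w, ψ, hdec, hsum⟩ := exists_traceForm_eq_extSum h
  obtain ⟨k, hk, hfin, hle⟩ :=
    exists_le_extSum hdec.nonneg (hdec.hasSum_weight hγ) (hsum ▸ h)
  exact ⟨ψ k, hdec.orthonormal.1 ⟨k, hk⟩, hfin, hle.trans hsum.ge⟩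

theorem exists_spectralDecomposition_of_traceForm_eq (hγ : IsDensityMatrix γ) {e : ℝ}
    (hle : ∀ ψ, ‖ψ‖ = 1 → IsFin (q ψ) → (e : EReal) ≤ q ψ) (he : traceForm q γ = e) :
    ∃ w ψ, IsSpectralDecomposition γ w ψ ∧ ∀ k, w k ≠ 0 → q (ψ k) = e := by
  obtain ⟨w, ψ, hdec, hsum⟩ := exists_traceForm_eq_extSum (he ▸ isFin_coe e)
  exact ⟨w, ψ, hdec, fun k => eq_of_extSum_eq hdec.nonneg (hdec.hasSum_weight hγ)
    (fun k hk => hle _ (hdec.orthonormal.1 ⟨k, hk⟩)) (hsum.symm.trans he)⟩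

theorem traceForm_rankOne {ψ : H} (hψ : ‖ψ‖ = 1) (hq : ∀ c : ℂ, ‖c‖ = 1 → q (c • ψ) = q ψ)
    (hfin : IsFin (q ψ)) : traceForm q (InnerProductSpace.rankOne ℂ ψ ψ) = q ψ := by
  have hdec : ∃ p : (ℕ → ℝ) × (ℕ → H),
      IsSpectralDecomposition (InnerProductSpace.rankOne ℂ ψ ψ) p.1 p.2 :=
    ⟨(_, _), isSpectralDecomposition_rankOne hψ⟩
  rw [traceForm, dif_pos hdec, ← hfin.coe_toReal]
  have hs := hdec.choose_spec
  refine extSum_eq_of_forall_eq (hs.hasSum_weight (isDensityMatrix_rankOne hψ)) fun k hk => ?_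
  have hmul : hdec.choose.2 k = ((hdec.choose.1 k : ℂ)⁻¹ * ⟪ψ, hdec.choose.2 k⟫_ℂ) • ψ := by
    have heig := hs.apply_eigenvector hk
    rw [InnerProductSpace.rankOne_apply] at heig
    rw [mul_smul, heig, inv_smul_smul₀ (Complex.ofReal_ne_zero.2 hk)]
  have hphase : ‖(hdec.choose.1 k : ℂ)⁻¹ * ⟪ψ, hdec.choose.2 k⟫_ℂ‖ = 1 := by
    have hunit : ‖hdec.choose.2 k‖ = 1 := hs.orthonormal.1 ⟨k, hk⟩
    rwa [hmul, norm_smul, hψ, mul_one] at hunit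
  rw [hfin.coe_toReal, hmul, hq _ hphase]

end Averages

/-! ### Quadratic forms -/

section Quadratic

variable {V : Type*} [AddCommGroup V] [Module ℂ V]

/-- The quadratic form of a sesquilinear Hermitian form on a complex vector space, characterized by
the parallelogram law rather than by its polarization. -/
structure IsQuadratic (q : V → ℝ) : Prop where
  smul : ∀ (c : ℂ) v, q (c • v) = ‖c‖ ^ 2 * q v
  parallelogram : ∀ v w, q (v + w) + q (v - w) = 2 * (q v + q w)

namespace IsQuadratic

variable {q q' : V → ℝ}

theorem zero : IsQuadratic fun _ : V => (0 : ℝ) := ⟨by simp, by simp⟩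

theorem add (h : IsQuadratic q) (h' : IsQuadratic q') : IsQuadratic fun v => q v + q' v where
  smul c v := by rw [h.smul, h'.smul, mul_add]
  parallelogram v w := by linear_combination h.parallelogram v w + h'.parallelogram v w

theorem const_mul (h : IsQuadratic q) (r : ℝ) : IsQuadratic fun v => r * q v where
  smul c v := by rw [h.smul, mul_left_comm]
  parallelogram v w := by linear_combination r * h.parallelogram v w

theorem sum {ι : Type*} {s : Finset ι} {q : ι → V → ℝ} (h : ∀ i ∈ s, IsQuadratic (q i)) :
    IsQuadratic fun v => ∑ i ∈ s, q i v := by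
  classical
  induction s using Finset.induction_on with
  | empty => simpa using zero
  | insert i s hi ih =>
    simpa only [Finset.sum_insert hi] using (h i (Finset.mem_insert_self i s)).add
      (ih fun j hj => h j (Finset.mem_insert_of_mem hj))

variable {H : Type*} [NormedAddCommGroup H] [InnerProductSpace ℂ H]

theorem re_inner (A B : V →ₗ[ℂ] H) : IsQuadratic fun v => (⟪A v, B v⟫_ℂ).re where
  smul c v := by
    rw [map_smul, map_smul, inner_smul_left, inner_smul_right, ← mul_assoc,
      Complex.conj_mul', ← Complex.ofReal_pow, Complex.re_ofReal_mul]
  parallelogram v w := by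
    simp only [map_add, map_sub, inner_add_left, inner_add_right, inner_sub_left, inner_sub_right,
      Complex.add_re, Complex.sub_re]
    ring

theorem norm_sq (A : V →ₗ[ℂ] H) : IsQuadratic fun v => ‖A v‖ ^ 2 := by
  simpa only [← inner_self_eq_norm_sq (𝕜 := ℂ), RCLike.re_to_complex] using re_inner A A

/-- The null space of a nonnegative quadratic form, on which the parallelogram law leaves no room
for `q (v + w) > 0`. -/
def nullSpace (h : IsQuadratic q) (h0 : ∀ v, 0 ≤ q v) : Submodule ℂ V where
  carrier := {v | q v = 0}
  zero_mem' := by simpa using h.smul 0 0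
  add_mem' {v w} (hv : q v = 0) (hw : q w = 0) := by
    have := h.parallelogram v w
    rw [hv, hw] at this
    exact le_antisymm (by linarith [h0 (v - w)]) (h0 _)
  smul_mem' c v (hv : q v = 0) := by rw [mem_ofPred_eq, h.smul, hv, mul_zero]

end IsQuadratic

variable {H : Type*} [NormedAddCommGroup H] [InnerProductSpace ℂ H]

/-- A quadratic form with the value `+∞` outside of its form domain, a subspace of `H`. -/
def IsExtQuadratic (Q : H → EReal) : Prop :=
  ∃ (D : Submodule ℂ H) (q : D → ℝ),
    IsQuadratic q ∧ (∀ ψ : D, Q ψ = q ψ) ∧ ∀ ψ ∉ D, Q ψ = ⊤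

namespace IsExtQuadratic

variable {Q : H → EReal}

theorem ne_bot (h : IsExtQuadratic Q) (ψ : H) : Q ψ ≠ ⊥ := by
  obtain ⟨D, q, -, hcoe, htop⟩ := h
  by_cases hψ : ψ ∈ D
  · exact hcoe ⟨ψ, hψ⟩ ▸ EReal.coe_ne_bot _
  · exact htop ψ hψ ▸ top_ne_bot

theorem smul_of_norm_eq_one (h : IsExtQuadratic Q) {c : ℂ} (hc : ‖c‖ = 1) (ψ : H) :
    Q (c • ψ) = Q ψ := by
  obtain ⟨D, q, hq, hcoe, htop⟩ := h
  have hmem : c • ψ ∈ D ↔ ψ ∈ D := D.smul_mem_iff (norm_ne_zero_iff.1 (by simp [hc]))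
  by_cases hψ : ψ ∈ D
  · have hsmul := hcoe (c • ⟨ψ, hψ⟩)
    rwa [hq.smul, hc, one_pow, one_mul, ← hcoe] at hsmul
  · rw [htop _ hψ, htop _ (mt hmem.1 hψ)]

theorem eq_of_mem_span (h : IsExtQuadratic Q) {e : ℝ}
    (hle : ∀ ψ, ‖ψ‖ = 1 → IsFin (Q ψ) → (e : EReal) ≤ Q ψ) {S : Set H}
    (hS : ∀ ψ ∈ S, ‖ψ‖ = 1 ∧ Q ψ = e) {φ : H} (hφ : φ ∈ Submodule.span ℂ S) (hφ1 : ‖φ‖ = 1) :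
    Q φ = e := by
  obtain ⟨D, q, hq, hcoe, htop⟩ := h
  have hgap : IsQuadratic fun v : D => q v + -e * ‖D.subtype v‖ ^ 2 :=
    hq.add ((IsQuadratic.norm_sq D.subtype).const_mul (-e))
  have hnonneg (v : D) : 0 ≤ q v + -e * ‖D.subtype v‖ ^ 2 := by
    rcases eq_or_ne v 0 with rfl | hv
    · simpa using (hgap.smul 0 0).ge
    · have hv0 : ‖(v : H)‖ ≠ 0 := norm_ne_zero_iff.2 (mt D.coe_eq_zero.1 hv)
      set u : D := ((‖(v : H)‖⁻¹ : ℝ) : ℂ) • v with hu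
      have hu1 : ‖(u : H)‖ = 1 := by simp [hu, norm_smul, hv0]
      have heu := hle u hu1 (hcoe u ▸ isFin_coe _)
      rw [hcoe, EReal.coe_le_coe_iff, hu, hq.smul, Complex.norm_real, norm_inv, norm_norm,
        inv_pow, le_inv_mul_iff₀ (by positivity)] at heu
      simp only [Submodule.subtype_apply]
      linarith
  have hsub : S ⊆ (hgap.nullSpace hnonneg).map D.subtype := fun ψ hψ => by
    obtain ⟨hψ1, hψe⟩ := hS ψ hψ
    have hψD : ψ ∈ D := by
      by_contra hD
      exact EReal.coe_ne_top e (hψe ▸ htop ψ hD)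
    rw [hcoe ⟨ψ, hψD⟩, EReal.coe_eq_coe_iff] at hψe
    exact ⟨⟨ψ, hψD⟩, by simp [IsQuadratic.nullSpace, hψe, hψ1], rfl⟩
  obtain ⟨v, hv, rfl⟩ := Submodule.span_le.2 hsub hφ
  have hv0 : q v + -e * ‖D.subtype v‖ ^ 2 = 0 := hv
  rw [hφ1] at hv0
  exact (hcoe v).trans (congrArg _ (by linarith))

end IsExtQuadratic

end Quadratic

/-! ### Pure states -/

section Pure

variable {H : Type*} [NormedAddCommGroup H] [InnerProductSpace ℂ H]

theorem traceNorm_zero : traceNorm (0 : H →L[ℂ] H) = 0 := by simp [traceNorm]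

variable [CompleteSpace H] {K : Type*} [MeasurableSpace K]

open Classical in
/-- The state-valued measure `|ψ⟩⟨ψ| δ_z`. -/
def pureState (ψ : H) (hψ : ‖ψ‖ = 1) (z : K) : StateValuedMeasure K H where
  toFun S := if z ∈ S then InnerProductSpace.rankOne ℂ ψ ψ else 0
  positive S _ := by
    split_ifs
    · exact InnerProductSpace.isPositive_rankOne_self ψ
    · exact ContinuousLinearMap.isPositive_zero
  traceClass S _ := by
    split_ifs
    · exact (isDensityMatrix_rankOne hψ).2.trans_lt ENNReal.one_lt_top
    · exact traceNorm_zero.trans_lt ENNReal.zero_lt_top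
  empty := if_neg (notMem_empty z)
  additive S _ hS := by
    refine tendsto_const_nhds.congr' ?_
    by_cases hz : ∃ n, z ∈ S n
    · obtain ⟨n, hn⟩ := hz
      have hother (k : ℕ) (hk : k ≠ n) : z ∉ S k :=
        fun hzk => Set.disjoint_left.1 (hS hk) hzk hn
      filter_upwards [eventually_ge_atTop {n}] with F hF
      have hnF : n ∈ F := hF (Finset.mem_singleton_self n)
      rw [if_pos (mem_iUnion.2 ⟨n, hn⟩), Finset.sum_eq_single_of_mem n hnF
        fun k _ hk => if_neg (hother k hk), if_pos hn, sub_self, traceNorm_zero]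
    · refine Eventually.of_forall fun F => ?_
      simp only [if_neg (mt mem_iUnion.1 hz), if_neg (not_exists.1 hz _), Finset.sum_const_zero,
        sub_self, traceNorm_zero]
  normalized := (congrArg traceNorm (if_pos (mem_univ z))).trans (isDensityMatrix_rankOne hψ).2

variable {ψ : H}

theorem isRadonNikodym_pureState (hψ : ‖ψ‖ = 1) (z : K) :
    IsRadonNikodym (pureState ψ hψ z) (Measure.dirac z)
      (fun _ => InnerProductSpace.rankOne ℂ ψ ψ) where
  prob := inferInstance
  density := Eventually.of_forall fun _ => isDensityMatrix_rankOne hψ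
  measurable _ _ := aestronglyMeasurable_const
  eq_integral S hS φ χ := by
    by_cases hz : z ∈ S <;> simp [pureState, hz, hS, Measure.real]

theorem svmEnergy_pureState [TopologicalSpace.SeparableSpace H] [MeasurableSingletonClass K]
    {E : H → K → EReal} {z : K}
    (hE : ∀ c : ℂ, ‖c‖ = 1 → E (c • ψ) z = E ψ z) (hψ : ‖ψ‖ = 1) (hfin : IsFin (E ψ z)) :
    svmEnergy E (pureState ψ hψ z) = E ψ z := by
  have hpure := isRadonNikodym_pureState hψ z
  have hex : ∃ p : Measure K × (K → H →L[ℂ] H), IsRadonNikodym (pureState ψ hψ z) p.1 p.2 :=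
    ⟨(_, _), hpure⟩
  have hrn : IsRadonNikodym (pureState ψ hψ z) hex.choose.1 hex.choose.2 := hex.choose_spec
  have hμ : hex.choose.1 = Measure.dirac z := hrn.measure_eq hpure
  have hγ : hex.choose.2 z = InnerProductSpace.rankOne ℂ ψ ψ := by
    have hae := hrn.density_ae_eq (hμ ▸ hpure)
    rwa [hμ, EventuallyEq, ae_dirac_eq] at hae
  have htrace : traceForm (fun φ => E φ z) (hex.choose.2 z) = E ψ z := by
    rw [hγ]
    exact traceForm_rankOne hψ hE hfin
  rw [svmEnergy, dif_pos hex, hμ, extIntegral_dirac (by rwa [htrace]), htrace]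

end Pure

/-! ### The four variational problems -/

section Variational

theorem isMinimizer_iff {α : Type*} {D : Set α} {F : α → EReal} {a : α} :
    IsMinimizer D F a ↔ a ∈ D ∧ ∀ b ∈ D, F a ≤ F b :=
  and_congr_right fun ha =>
    ⟨fun h _ hb => h.trans_le (iInf₂_le _ hb), fun h => (le_iInf₂ h).antisymm (iInf₂_le a ha)⟩

theorem exists_isMinimizer_iff {α β : Type*} {D : Set α} {F : α → EReal} {D' : Set β}
    {F' : β → EReal} (h : ∀ a ∈ D, ∃ b ∈ D', F' b ≤ F a) (h' : ∀ b ∈ D', ∃ a ∈ D, F a ≤ F' b) :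
    (∃ a, IsMinimizer D F a) ↔ ∃ b, IsMinimizer D' F' b := by
  simp only [isMinimizer_iff]
  constructor
  · rintro ⟨a, ha, hmin⟩
    obtain ⟨b, hb, hba⟩ := h a ha
    refine ⟨b, hb, fun b' hb' => ?_⟩
    obtain ⟨a', ha', hab'⟩ := h' b' hb'
    exact hba.trans ((hmin a' ha').trans hab')
  · rintro ⟨b, hb, hmin⟩
    obtain ⟨a, ha, hab⟩ := h' b hb
    refine ⟨a, ha, fun a' ha' => ?_⟩
    obtain ⟨b', hb', hba'⟩ := h a' ha'
    exact hab.trans ((hmin b' hb').trans hba')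

variable {H : Type*} [NormedAddCommGroup H] {K : Type*} {E : H → K → EReal}

theorem exists_isQcMinimizer_iff_exists_isPekarMinimizer {P : H → EReal}
    (hbot : ∀ ψ z, E ψ z ≠ ⊥) (hP : ∀ ψ, ‖ψ‖ = 1 → P ψ = pekarInf E ψ)
    (hattained : ∀ ψ, ‖ψ‖ = 1 → ∃ z, E ψ z = pekarInf E ψ) :
    (∃ p, IsQcMinimizer E p) ↔ ∃ ψ, IsPekarMinimizer P ψ := by
  refine exists_isMinimizer_iff ?_ ?_
  · rintro ⟨ψ, z⟩ ⟨hψ, hfin⟩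
    obtain ⟨z₀, hz₀⟩ := hattained ψ hψ
    have hle : P ψ ≤ E ψ z := (hP ψ hψ).trans_le (iInf_le _ z)
    refine ⟨ψ, ⟨hψ, ?_, (hle.trans_lt hfin.2.lt_top).ne⟩, hle⟩
    rw [hP ψ hψ, ← hz₀]
    exact hbot ψ z₀
  · rintro ψ ⟨hψ, hfin⟩
    obtain ⟨z₀, hz₀⟩ := hattained ψ hψ
    have heq : E ψ z₀ = P ψ := hz₀.trans (hP ψ hψ).symm
    exact ⟨(ψ, z₀), ⟨hψ, heq ▸ hfin⟩, heq.le⟩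

variable [MeasurableSpace K]

theorem exists_isQcMinimizer_iff_exists_isPmMinimizer [MeasurableSingletonClass K] :
    (∃ p, IsQcMinimizer E p) ↔ ∃ p, IsPmMinimizer E p := by
  refine exists_isMinimizer_iff ?_ ?_
  · rintro ⟨ψ, z⟩ ⟨hψ, hfin⟩
    have hdirac : pmEnergy E (ψ, Measure.dirac z) = E ψ z := extIntegral_dirac hfin
    exact ⟨(ψ, Measure.dirac z), ⟨hψ, inferInstance, hdirac ▸ hfin⟩, hdirac.le⟩
  · rintro ⟨ψ, μ⟩ ⟨hψ, hμ, hfin⟩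
    have : IsProbabilityMeasure μ := hμ
    obtain ⟨z, -, hz, hle⟩ := exists_le_extIntegral (p := fun _ => True) (by simp) hfin
    exact ⟨(ψ, z), ⟨hψ, hz⟩, hle⟩

variable [InnerProductSpace ℂ H] [CompleteSpace H]

theorem exists_svmEnergy_eq_extIntegral {m : StateValuedMeasure K H}
    (h : IsFin (svmEnergy E m)) :
    ∃ μ γ, IsRadonNikodym m μ γ ∧
      svmEnergy E m = extIntegral μ fun z => traceForm (fun ψ => E ψ z) (γ z) := by
  unfold svmEnergy at h ⊢
  split_ifs at h ⊢ with hdec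
  · exact ⟨_, _, hdec.choose_spec, rfl⟩
  · exact absurd rfl h.2

theorem exists_le_svmEnergy {m : StateValuedMeasure K H} (h : IsFin (svmEnergy E m)) :
    ∃ ψ z, ‖ψ‖ = 1 ∧ IsFin (E ψ z) ∧ E ψ z ≤ svmEnergy E m := by
  obtain ⟨μ, γ, hrn, hm⟩ := exists_svmEnergy_eq_extIntegral h
  have := hrn.prob
  obtain ⟨z, hγ, hfin, hle⟩ := exists_le_extIntegral hrn.density (hm ▸ h)
  obtain ⟨ψ, hψ, hfinψ, hleψ⟩ := exists_le_traceForm hγ hfin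
  exact ⟨ψ, z, hψ, hfinψ, hleψ.trans (hle.trans hm.ge)⟩

variable [TopologicalSpace.SeparableSpace H] [MeasurableSingletonClass K]

theorem exists_isQcMinimizer_iff_exists_isSvmMinimizer
    (hE : ∀ z, IsExtQuadratic fun ψ => E ψ z) :
    (∃ p, IsQcMinimizer E p) ↔ ∃ m, IsSvmMinimizer E m := by
  refine exists_isMinimizer_iff ?_ fun m hm => ?_
  · rintro ⟨ψ, z⟩ ⟨hψ, hfin⟩
    have hpure := svmEnergy_pureState (fun c hc => (hE z).smul_of_norm_eq_one hc ψ) hψ hfin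
    exact ⟨pureState ψ hψ z, by rwa [mem_ofPred_eq, hpure], hpure.le⟩
  · obtain ⟨ψ, z, hψ, hfin, hle⟩ := exists_le_svmEnergy hm
    exact ⟨(ψ, z), ⟨hψ, hfin⟩, hle⟩

theorem tfae_exists_minimizer (hE : ∀ z, IsExtQuadratic fun ψ => E ψ z) {P : H → EReal}
    (hP : ∀ ψ, ‖ψ‖ = 1 → P ψ = pekarInf E ψ)
    (hattained : ∀ ψ, ‖ψ‖ = 1 → ∃ z, E ψ z = pekarInf E ψ) :
    [∃ p, IsQcMinimizer E p, ∃ ψ, IsPekarMinimizer P ψ, ∃ m, IsSvmMinimizer E m,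
      ∃ p, IsPmMinimizer E p].TFAE := by
  tfae_have 1 ↔ 2 := exists_isQcMinimizer_iff_exists_isPekarMinimizer
    (fun ψ z => (hE z).ne_bot ψ) hP hattained
  tfae_have 1 ↔ 3 := exists_isQcMinimizer_iff_exists_isSvmMinimizer hE
  tfae_have 1 ↔ 4 := exists_isQcMinimizer_iff_exists_isPmMinimizer
  tfae_finish

theorem IsSvmMinimizer.svmEnergy_le (hE : ∀ z, IsExtQuadratic fun ψ => E ψ z)
    {m : StateValuedMeasure K H} (hm : IsSvmMinimizer E m) {ψ : H} {z : K} (hψ : ‖ψ‖ = 1)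
    (hfin : IsFin (E ψ z)) : svmEnergy E m ≤ E ψ z := by
  have hpure := svmEnergy_pureState (fun c hc => (hE z).smul_of_norm_eq_one hc ψ) hψ hfin
  rw [← hpure] at hfin ⊢
  exact (isMinimizer_iff.1 hm).2 _ hfin

theorem IsSvmMinimizer.isConcentratedOnMinimizers (hE : ∀ z, IsExtQuadratic fun ψ => E ψ z)
    {m : StateValuedMeasure K H} (hm : IsSvmMinimizer E m) : IsConcentratedOnMinimizers E m := by
  have hfin : IsFin (svmEnergy E m) := hm.1
  set e := (svmEnergy E m).toReal
  have hle (ψ : H) (z : K) (hψ : ‖ψ‖ = 1) (hψz : IsFin (E ψ z)) : (e : EReal) ≤ E ψ z :=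
    hfin.coe_toReal.trans_le (hm.svmEnergy_le hE hψ hψz)
  obtain ⟨μ, γ, hrn, hsvm⟩ := exists_svmEnergy_eq_extIntegral hfin
  have := hrn.prob
  have hground : ∀ᵐ z ∂μ, traceForm (fun ψ => E ψ z) (γ z) = e := by
    refine ae_eq_of_extIntegral_eq ?_ (hsvm.symm.trans hfin.coe_toReal.symm)
    filter_upwards [hrn.density] with z hγ hγz
    obtain ⟨ψ, hψ, hψz, hψγ⟩ := exists_le_traceForm hγ hγz
    exact (hle ψ z hψ hψz).trans hψγ
  refine ⟨⟨μ, γ, hrn⟩, fun μ' γ' hrn' => ?_⟩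
  obtain rfl := hrn.measure_eq hrn'
  filter_upwards [hground, hrn.density, hrn.density_ae_eq hrn']
    with z hz hγ hγ' φ c hφ hc heigen
  obtain ⟨w, ψ, hdec, hψ⟩ :=
    exists_spectralDecomposition_of_traceForm_eq hγ (fun ψ => hle ψ z) hz
  have hspan := hdec.mem_span_of_eigenvector (hdec.hasSum_weight hγ).summable hc (hγ' ▸ heigen)
  have hφz : E φ z = e := by
    refine (hE z).eq_of_mem_span (fun ψ => hle ψ z) ?_ hspan hφ
    rintro _ ⟨k, hk, rfl⟩
    exact ⟨hdec.orthonormal.1 ⟨k, hk⟩, hψ k hk⟩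
  exact isMinimizer_iff.2
    ⟨⟨hφ, hφz ▸ isFin_coe e⟩, fun p hp => hφz.trans_le (hle p.1 p.2 hp.1 hp.2)⟩

end Variational

/-! ### Convex quadratic functions of the field -/

section ConvexQuadratic

variable {K : Type*} [NormedAddCommGroup K] [InnerProductSpace ℝ K]

/-- A continuous real polynomial of degree at most two with nonnegative quadratic part `B`, which is
described by its exact second order expansion around every point. -/
def IsConvexQuadratic (f : K → ℝ) : Prop :=
  ∃ (ℓ : K →L[ℝ] ℝ) (B : K →L[ℝ] K →L[ℝ] ℝ), (∀ v, 0 ≤ B v v) ∧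
    ∀ z v, f (z + v) = f z + (ℓ v + 2 * B z v) + B v v

namespace IsConvexQuadratic

variable {f g : K → ℝ}

theorem const (c : ℝ) : IsConvexQuadratic fun _ : K => c := ⟨0, 0, by simp, by simp⟩

theorem add (hf : IsConvexQuadratic f) (hg : IsConvexQuadratic g) :
    IsConvexQuadratic fun z => f z + g z := by
  obtain ⟨ℓ, B, hB, hf⟩ := hf
  obtain ⟨ℓ', B', hB', hg⟩ := hg
  refine ⟨ℓ + ℓ', B + B', fun v => add_nonneg (hB v) (hB' v), fun z v => ?_⟩
  simp only [hf, hg, _root_.add_apply]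
  ring

theorem const_mul (hf : IsConvexQuadratic f) {a : ℝ} (ha : 0 ≤ a) :
    IsConvexQuadratic fun z => a * f z := by
  obtain ⟨ℓ, B, hB, hf⟩ := hf
  refine ⟨a • ℓ, a • B, fun v => mul_nonneg ha (hB v), fun z v => ?_⟩
  simp only [hf, _root_.smul_apply, smul_eq_mul]
  ring

theorem sum {ι : Type*} {s : Finset ι} {f : ι → K → ℝ} (h : ∀ i ∈ s, IsConvexQuadratic (f i)) :
    IsConvexQuadratic fun z => ∑ i ∈ s, f i z := by
  classical
  induction s using Finset.induction_on with
  | empty => simpa using const 0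
  | insert i s hi ih =>
    simpa only [Finset.sum_insert hi] using (h i (Finset.mem_insert_self i s)).add
      (ih fun j hj => h j (Finset.mem_insert_of_mem hj))

variable {H : Type*} [NormedAddCommGroup H] [InnerProductSpace ℝ H]

theorem inner (u : H) (S : K →L[ℝ] H) : IsConvexQuadratic fun z => ⟪u, S z⟫_ℝ :=
  ⟨innerSL ℝ u ∘L S, 0, by simp, by simp [inner_add_right]⟩

theorem norm_sq_add (u : H) (S : K →L[ℝ] H) : IsConvexQuadratic fun z => ‖u + S z‖ ^ 2 := by
  refine ⟨(2 : ℝ) • innerSL ℝ u ∘L S, (innerSL ℝ).bilinearComp S S, by simp, fun z v => ?_⟩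
  beta_reduce
  rw [map_add, ← add_assoc, norm_add_sq_real, inner_add_left]
  simp [mul_add]

theorem norm_sq : IsConvexQuadratic fun z : K => ‖z‖ ^ 2 := by
  simpa using norm_sq_add 0 (.id ℝ K)

theorem hasDerivAt_of_expansion {ℓ : K →L[ℝ] ℝ} {B : K →L[ℝ] K →L[ℝ] ℝ}
    (h : ∀ z v, f (z + v) = f z + (ℓ v + 2 * B z v) + B v v) (z v : K) :
    HasDerivAt (fun t : ℝ => f (z + t • v)) (ℓ v + 2 * B z v) 0 := by
  have hline (t : ℝ) :
      f (z + t • v) = f z + t * (ℓ v + 2 * B z v) + t ^ 2 * B v v := by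
    rw [h]
    simp only [map_smul, _root_.smul_apply, smul_eq_mul]
    ring
  simp only [hline]
  simpa using (((hasDerivAt_id (0 : ℝ)).mul_const (ℓ v + 2 * B z v)).const_add (f z)).fun_add
    (((hasDerivAt_id (0 : ℝ)).fun_pow 2).mul_const (B v v))

theorem le_of_hasDerivAt_zero (hf : IsConvexQuadratic f) {z : K}
    (hz : ∀ v, HasDerivAt (fun t : ℝ => f (z + t • v)) 0 0) (y : K) : f z ≤ f y := by
  obtain ⟨ℓ, B, hB, h⟩ := hf
  have hcrit := (hasDerivAt_of_expansion h z (y - z)).unique (hz (y - z))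
  have hexp := h z (y - z)
  rw [hcrit, add_sub_cancel] at hexp
  linarith [hB (y - z)]

/-- With `‖z‖²` added the quadratic part becomes coercive, and the critical point solves the
corresponding Lax-Milgram equation. -/
theorem exists_hasDerivAt_add_norm_sq_zero [CompleteSpace K] (hf : IsConvexQuadratic f) :
    ∃ z, ∀ v, HasDerivAt (fun t : ℝ => f (z + t • v) + ‖z + t • v‖ ^ 2) 0 0 := by
  obtain ⟨ℓ, B₀, hB₀, h₀⟩ := hf
  let J : K →L[ℝ] K →L[ℝ] ℝ := innerSL ℝ
  obtain ⟨B, hB⟩ : ∃ B : K →L[ℝ] K →L[ℝ] ℝ, ∀ z v, B z v = B₀ z v + ⟪z, v⟫_ℝ :=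
    ⟨B₀ + J, fun _ _ => rfl⟩
  have hexp (z v : K) : f (z + v) + ‖z + v‖ ^ 2
      = f z + ‖z‖ ^ 2 + (ℓ v + 2 * B z v) + B v v := by
    rw [h₀, norm_add_sq_real, hB, hB, real_inner_self_eq_norm_sq]
    ring
  have hcoercive : IsCoercive B := by
    refine ⟨1, one_pos, fun v => ?_⟩
    rw [hB, real_inner_self_eq_norm_mul_norm, one_mul]
    exact le_add_of_nonneg_left (hB₀ v)
  let z := hcoercive.continuousLinearEquivOfBilin.symm
    ((-(1 / 2) : ℝ) • (InnerProductSpace.toDual ℝ K).symm ℓ)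
  have hz (v : K) : B z v = -(1 / 2) * ℓ v := by
    rw [← hcoercive.continuousLinearEquivOfBilin_apply, ContinuousLinearEquiv.apply_symm_apply,
      real_inner_smul_left, InnerProductSpace.toDual_symm_apply]
  refine ⟨z, fun v => ?_⟩
  have hderiv := hasDerivAt_of_expansion (f := fun z => f z + ‖z‖ ^ 2) hexp z v
  rwa [hz, show ℓ v + 2 * (-(1 / 2) * ℓ v) = 0 by ring] at hderiv

end IsConvexQuadratic

end ConvexQuadratic

/-! ### The Pekar functional -/

section Pekar

attribute [local instance] InnerProductSpace.complexToReal

variable {H K : Type*} [NormedAddCommGroup K] [InnerProductSpace ℂ K]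
variable {E : H → K → EReal} {ψ : H} {g : K → ℝ}

theorem isCriticalField_iff (hE : ∀ z, E ψ z = g z) (z : K) :
    IsCriticalField E ψ z ↔ ∀ v : K, HasDerivAt (fun t : ℝ => g (z + t • v)) 0 0 := by
  simp only [IsCriticalField, hE, EReal.toReal_coe, isFin_coe, true_and, Complex.coe_smul]

theorem IsCriticalField.eq_pekarInf (hE : ∀ z, E ψ z = g z) (hg : IsConvexQuadratic g) {z : K}
    (hz : IsCriticalField E ψ z) : E ψ z = pekarInf E ψ := by
  refine (le_iInf fun y => ?_).antisymm (iInf_le _ z)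
  rw [hE, hE, EReal.coe_le_coe_iff]
  exact hg.le_of_hasDerivAt_zero ((isCriticalField_iff hE z).1 hz) y

end Pekar

/-! ### Forms depending on the field -/

section FieldCoupledForm

attribute [local instance] InnerProductSpace.complexToReal

variable {V : Type*} [AddCommGroup V] [Module ℂ V]
variable {K : Type*} [NormedAddCommGroup K] [InnerProductSpace ℂ K]

/-- A quadratic form `f z` of the particles which depends on the field `z` as a convex quadratic
function: the part of the energy which does not contain the field energy. -/
structure IsFieldCoupledForm (f : K → V → ℝ) : Prop where
  quadratic : ∀ z, IsQuadratic (f z)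
  convex : ∀ v, IsConvexQuadratic fun z => f z v

namespace IsFieldCoupledForm

variable {f f' : K → V → ℝ}

theorem add (h : IsFieldCoupledForm f) (h' : IsFieldCoupledForm f') :
    IsFieldCoupledForm fun z v => f z v + f' z v :=
  ⟨fun z => (h.quadratic z).add (h'.quadratic z), fun v => (h.convex v).add (h'.convex v)⟩

theorem const_mul (h : IsFieldCoupledForm f) {a : ℝ} (ha : 0 ≤ a) :
    IsFieldCoupledForm fun z v => a * f z v :=
  ⟨fun z => (h.quadratic z).const_mul a, fun v => (h.convex v).const_mul ha⟩

theorem sum {ι : Type*} {s : Finset ι} {f : ι → K → V → ℝ}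
    (h : ∀ i ∈ s, IsFieldCoupledForm (f i)) : IsFieldCoupledForm fun z v => ∑ i ∈ s, f i z v :=
  ⟨fun z => .sum fun i hi => (h i hi).quadratic z, fun v => .sum fun i hi => (h i hi).convex v⟩

theorem of_isQuadratic {q : V → ℝ} (hq : IsQuadratic q) :
    IsFieldCoupledForm fun (_ : K) v => q v :=
  ⟨fun _ => hq, fun v => .const (q v)⟩

variable {H H' : Type*} [NormedAddCommGroup H] [InnerProductSpace ℂ H]
variable [NormedAddCommGroup H'] [InnerProductSpace ℂ H']

theorem re_inner (A : V →ₗ[ℂ] H) (B : V →ₗ[ℂ] H') (M : K →L[ℝ] H' →L[ℂ] H) :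
    IsFieldCoupledForm fun z v => (⟪A v, M z (B v)⟫_ℂ).re where
  quadratic z := .re_inner A ((M z).toLinearMap ∘ₗ B)
  convex v := .inner (A v) ((ContinuousLinearMap.apply ℂ H (B v)).restrictScalars ℝ ∘L M)

theorem norm_sq_add (A : V →ₗ[ℂ] H) (B : V →ₗ[ℂ] H') (M : K →L[ℝ] H' →L[ℂ] H) :
    IsFieldCoupledForm fun z v => ‖A v + M z (B v)‖ ^ 2 where
  quadratic z := .norm_sq (A + (M z).toLinearMap ∘ₗ B)
  convex v := .norm_sq_add (A v) ((ContinuousLinearMap.apply ℂ H (B v)).restrictScalars ℝ ∘L M)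

end IsFieldCoupledForm

end FieldCoupledForm

/-! ### Quasi-classical energies -/

section QuasiClassicalEnergy

attribute [local instance] InnerProductSpace.complexToReal

variable {H : Type*} [NormedAddCommGroup H] [InnerProductSpace ℂ H]
variable {K : Type*} [NormedAddCommGroup K] [InnerProductSpace ℂ K]

/-- An energy `⟨ψ, H_z ψ⟩ = f z ψ + ‖z‖² ‖ψ‖²` which consists of a field coupled form, with a form
domain independent of the field, and the field energy. -/
def IsQuasiClassicalEnergy (E : H → K → EReal) : Prop :=
  ∃ (D : Submodule ℂ H) (f : K → D → ℝ), IsFieldCoupledForm f ∧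
    (∀ (ψ : D) z, E ψ z = (f z ψ + ‖z‖ ^ 2 * ‖ψ‖ ^ 2 : ℝ)) ∧ ∀ ψ ∉ D, ∀ z, E ψ z = ⊤

namespace IsQuasiClassicalEnergy

variable {E : H → K → EReal}

theorem isExtQuadratic (hE : IsQuasiClassicalEnergy E) (z : K) :
    IsExtQuadratic fun ψ => E ψ z := by
  obtain ⟨D, f, hf, hcoe, htop⟩ := hE
  exact ⟨D, _, (hf.quadratic z).add ((IsQuadratic.norm_sq D.subtype).const_mul (‖z‖ ^ 2)),
    fun ψ => hcoe ψ z, fun ψ hψ => htop ψ hψ z⟩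

theorem exists_isConvexQuadratic_or_eq_top (hE : IsQuasiClassicalEnergy E) {ψ : H}
    (hψ : ‖ψ‖ = 1) :
    (∃ g, IsConvexQuadratic g ∧ ∀ z, E ψ z = (g z + ‖z‖ ^ 2 : ℝ)) ∨ ∀ z, E ψ z = ⊤ := by
  obtain ⟨D, f, hf, hcoe, htop⟩ := hE
  by_cases hψD : ψ ∈ D
  · refine .inl ⟨fun z => f z ⟨ψ, hψD⟩, hf.convex _, fun z => ?_⟩
    simpa [hψ] using hcoe ⟨ψ, hψD⟩ z
  · exact .inr (htop ψ hψD)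

variable [CompleteSpace K]

theorem pekarCritical_eq_pekarInf (hE : IsQuasiClassicalEnergy E) {ψ : H} (hψ : ‖ψ‖ = 1) :
    pekarCritical E ψ = pekarInf E ψ := by
  rcases hE.exists_isConvexQuadratic_or_eq_top hψ with ⟨g, hg, hgE⟩ | htop
  · have hex : ∃ z, IsCriticalField E ψ z :=
      hg.exists_hasDerivAt_add_norm_sq_zero.imp fun z => (isCriticalField_iff hgE z).2
    rw [pekarCritical, dif_pos hex]
    exact hex.choose_spec.eq_pekarInf hgE (hg.add .norm_sq)
  · rw [pekarCritical, dif_neg fun ⟨z, hz⟩ => hz.1.2 (htop z)]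
    simp only [pekarInf, htop, iInf_top]

theorem exists_eq_pekarInf (hE : IsQuasiClassicalEnergy E) {ψ : H} (hψ : ‖ψ‖ = 1) :
    ∃ z, E ψ z = pekarInf E ψ := by
  rcases hE.exists_isConvexQuadratic_or_eq_top hψ with ⟨g, hg, hgE⟩ | htop
  · obtain ⟨z, hz⟩ := hg.exists_hasDerivAt_add_norm_sq_zero
    exact ⟨z, ((isCriticalField_iff hgE z).2 hz).eq_pekarInf hgE (hg.add .norm_sq)⟩
  · exact ⟨0, by simp only [pekarInf, htop, iInf_top]⟩

variable [CompleteSpace H] [TopologicalSpace.SeparableSpace H]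
variable [MeasurableSpace K] [MeasurableSingletonClass K]

theorem tfae_exists_minimizer_pekarInf (hE : IsQuasiClassicalEnergy E) :
    [∃ p, IsQcMinimizer E p, ∃ ψ, IsPekarMinimizer (pekarInf E) ψ, ∃ m, IsSvmMinimizer E m,
      ∃ p, IsPmMinimizer E p].TFAE :=
  tfae_exists_minimizer hE.isExtQuadratic (fun _ _ => rfl) fun _ => hE.exists_eq_pekarInf

theorem tfae_exists_minimizer_pekarCritical (hE : IsQuasiClassicalEnergy E) :
    [∃ p, IsQcMinimizer E p, ∃ ψ, IsPekarMinimizer (pekarCritical E) ψ, ∃ m, IsSvmMinimizer E m,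
      ∃ p, IsPmMinimizer E p].TFAE :=
  tfae_exists_minimizer hE.isExtQuadratic (fun _ => hE.pekarCritical_eq_pekarInf)
    fun _ => hE.exists_eq_pekarInf

end IsQuasiClassicalEnergy

end QuasiClassicalEnergy

/-! ### Multiplication by bounded functions depending linearly on the field -/

section Coupling

variable {K : Type*} [SeminormedAddCommGroup K] [NormedSpace ℝ K]
variable {X : Type*} [MeasurableSpace X] {μ : Measure X}

/-- A potential `a z` which is essentially bounded by a multiple of `‖z‖` and depends linearly on
the field `z`. -/
structure IsCoupling (μ : Measure X) (a : K → X → ℝ) : Prop where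
  aestronglyMeasurable : ∀ z, AEStronglyMeasurable (a z) μ
  bound : ∃ M, ∀ z, ∀ᵐ x ∂μ, ‖a z x‖ ≤ M * ‖z‖
  add : ∀ z w x, a (z + w) x = a z x + a w x
  smul : ∀ (t : ℝ) z x, a (t • z) x = t * a z x

namespace IsCoupling

variable {a : K → X → ℝ}

theorem comp {Y : Type*} [MeasurableSpace Y] {ν : Measure Y} {f : Y → X} (ha : IsCoupling μ a)
    (hf : Measure.QuasiMeasurePreserving f ν μ) : IsCoupling ν fun z y => a z (f y) where
  aestronglyMeasurable z := (ha.aestronglyMeasurable z).comp_quasiMeasurePreserving hf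
  bound := ha.bound.imp fun _ h z => hf.ae (h z)
  add z w y := ha.add z w (f y)
  smul t z y := ha.smul t z (f y)

theorem const_mul (ha : IsCoupling μ a) (c : ℝ) : IsCoupling μ fun z x => c * a z x where
  aestronglyMeasurable z := (ha.aestronglyMeasurable z).const_mul c
  bound := by
    obtain ⟨M, h⟩ := ha.bound
    refine ⟨‖c‖ * M, fun z => (h z).mono fun x hx => ?_⟩
    rw [norm_mul, mul_assoc]
    gcongr
  add z w x := by rw [ha.add, mul_add]
  smul t z x := by rw [ha.smul, mul_left_comm]

theorem re_inner {𝔥 : Type*} [NormedAddCommGroup 𝔥] [InnerProductSpace ℂ 𝔥] (S : K →L[ℝ] 𝔥)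
    {g : X → 𝔥} {C : ℝ} (hC : ∀ᵐ x ∂μ, ‖g x‖ ≤ C)
    (hg : ∀ u : 𝔥, AEStronglyMeasurable (fun x => ⟪u, g x⟫_ℂ) μ) :
    IsCoupling μ fun z x => (⟪S z, g x⟫_ℂ).re where
  aestronglyMeasurable z := Complex.continuous_re.comp_aestronglyMeasurable (hg (S z))
  bound := by
    refine ⟨‖S‖ * C, fun z => hC.mono fun x hx => ?_⟩
    calc ‖(⟪S z, g x⟫_ℂ).re‖ ≤ ‖S z‖ * ‖g x‖ :=
          (Complex.abs_re_le_norm _).trans (norm_inner_le_norm _ _)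
      _ ≤ ‖S‖ * ‖z‖ * C := by
          gcongr
          exact S.le_opNorm z
      _ = ‖S‖ * C * ‖z‖ := by ring
  add z w x := by rw [map_add, inner_add_left, Complex.add_re]
  smul t z x := by
    rw [map_smul, ← Complex.coe_smul, inner_smul_left, Complex.conj_ofReal, Complex.re_ofReal_mul]

theorem memLp_ofReal (ha : IsCoupling μ a) (z : K) : MemLp (fun x => (a z x : ℂ)) ∞ μ := by
  obtain ⟨M, h⟩ := ha.bound
  refine memLp_top_of_bound
    (Complex.continuous_ofReal.comp_aestronglyMeasurable (ha.aestronglyMeasurable z)) (M * ‖z‖) ?_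
  filter_upwards [h z] with x hx
  rwa [Complex.norm_real]

theorem exists_norm_toLp_le (ha : IsCoupling μ a) :
    ∃ M, ∀ z, ‖(ha.memLp_ofReal z).toLp‖ ≤ M * ‖z‖ := by
  obtain ⟨M, hM⟩ := ha.bound
  refine ⟨|M|, fun z => ?_⟩
  rw [Lp.norm_toLp, eLpNorm_exponent_top]
  refine ENNReal.toReal_le_of_le_ofReal (by positivity) (eLpNormEssSup_le_of_ae_bound ?_)
  filter_upwards [hM z] with x hx
  rw [Complex.norm_real]
  exact hx.trans (by gcongr; exact le_abs_self M)

/-- The potentials `a z` as elements of `L^∞`. -/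
def toLpTop (ha : IsCoupling μ a) : K →L[ℝ] Lp ℂ ∞ μ :=
  LinearMap.mkContinuousOfExistsBound
    { toFun := fun z => (ha.memLp_ofReal z).toLp
      map_add' := fun z w => by
        rw [← MemLp.toLp_add]
        exact MemLp.toLp_congr _ _ (.of_forall fun x => by simp [ha.add])
      map_smul' := fun t z => by
        rw [RingHom.id_apply, ← MemLp.toLp_const_smul]
        exact MemLp.toLp_congr _ _ (.of_forall fun x => by simp [ha.smul]) }
    ha.exists_norm_toLp_le

theorem coeFn_toLpTop (ha : IsCoupling μ a) (z : K) :
    ha.toLpTop z =ᵐ[μ] fun x => (a z x : ℂ) := (ha.memLp_ofReal z).coeFn_toLp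

/-- The multiplication operators by the potentials `a z`. -/
def mul (ha : IsCoupling μ a) : K →L[ℝ] Lp ℂ 2 μ →L[ℂ] Lp ℂ 2 μ :=
  ((ContinuousLinearMap.mul ℂ ℂ).holderL μ ∞ 2 2).restrictScalars ℝ ∘L ha.toLpTop

theorem coeFn_mul (ha : IsCoupling μ a) (z : K) (ψ : Lp ℂ 2 μ) :
    ha.mul z ψ =ᵐ[μ] fun x => (a z x : ℂ) * ψ x := by
  filter_upwards [(ContinuousLinearMap.mul ℂ ℂ).coeFn_holder (r := 2) (ha.toLpTop z) ψ,
    ha.coeFn_toLpTop z] with x hmul ha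
  rw [← ha]
  exact hmul

theorem integral_mul_norm_sq (ha : IsCoupling μ a) (z : K) (ψ : Lp ℂ 2 μ) :
    ∫ x, a z x * ‖ψ x‖ ^ 2 ∂μ = (⟪ψ, ha.mul z ψ⟫_ℂ).re := by
  rw [L2.inner_def, ← RCLike.re_eq_complex_re, ← integral_re (L2.integrable_inner _ _)]
  refine integral_congr_ae ?_
  filter_upwards [ha.coeFn_mul z ψ] with x hx
  rw [hx, RCLike.inner_apply, mul_assoc, Complex.mul_conj, RCLike.re_eq_complex_re,
    Complex.re_ofReal_mul, Complex.ofReal_re, Complex.normSq_eq_norm_sq]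

theorem integral_conj_mul_mul (ha : IsCoupling μ a) (z : K) (ψ φ : Lp ℂ 2 μ) :
    ∫ x, (starRingEnd ℂ) (ψ x) * (a z x : ℂ) * φ x ∂μ = ⟪ψ, ha.mul z φ⟫_ℂ := by
  rw [L2.inner_def]
  refine integral_congr_ae ?_
  filter_upwards [ha.coeFn_mul z φ] with x hx
  rw [hx, RCLike.inner_apply]
  ring

theorem integral_norm_sq_add (ha : IsCoupling μ a) (z : K) (b : ℂ) (φ ψ : Lp ℂ 2 μ) :
    ∫ x, ‖b * φ x + (a z x : ℂ) * ψ x‖ ^ 2 ∂μ = ‖b • φ + ha.mul z ψ‖ ^ 2 := by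
  rw [@norm_sq_eq_re_inner ℂ, L2.inner_def, ← integral_re (L2.integrable_inner _ _)]
  refine integral_congr_ae ?_
  filter_upwards [ha.coeFn_mul z ψ, Lp.coeFn_add (b • φ) (ha.mul z ψ), Lp.coeFn_smul b φ]
    with x hmul hadd hsmul
  rw [← norm_sq_eq_re_inner, hadd, Pi.add_apply, hsmul, Pi.smul_apply, hmul, smul_eq_mul]

end IsCoupling

end Coupling

/-! ### The form domain -/

section WeightedNormSq

variable {X : Type*} [MeasurableSpace X] {μ : Measure X} {w : X → ℝ} {ψ φ : Lp ℂ 2 μ}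

theorem integrable_mul_norm_sq_add (hw : AEStronglyMeasurable w μ)
    (hψ : Integrable (fun x => w x * ‖ψ x‖ ^ 2) μ) (hφ : Integrable (fun x => w x * ‖φ x‖ ^ 2) μ) :
    Integrable (fun x => w x * ‖(ψ + φ) x‖ ^ 2) μ := by
  refine ((hψ.norm.add hφ.norm).const_mul 2).mono'
    (hw.mul ((Lp.aestronglyMeasurable _).norm.pow 2)) ?_
  filter_upwards [Lp.coeFn_add ψ φ] with x hadd
  have hsq : ‖ψ x + φ x‖ ^ 2 ≤ 2 * (‖ψ x‖ ^ 2 + ‖φ x‖ ^ 2) :=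
    (pow_le_pow_left₀ (norm_nonneg _) (norm_add_le _ _) 2).trans add_sq_le
  simp only [hadd, Pi.add_apply, norm_mul, norm_pow, norm_norm]
  linarith [mul_le_mul_of_nonneg_left hsq (norm_nonneg (w x))]

theorem mul_norm_sq_smul_ae_eq (w : X → ℝ) (c : ℂ) (ψ : Lp ℂ 2 μ) :
    (fun x => w x * ‖(c • ψ) x‖ ^ 2) =ᵐ[μ] fun x => ‖c‖ ^ 2 * (w x * ‖ψ x‖ ^ 2) := by
  filter_upwards [Lp.coeFn_smul c ψ] with x hsmul
  rw [hsmul, Pi.smul_apply, norm_smul]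
  ring

theorem integral_mul_norm_sq_parallelogram
    (hadd : Integrable (fun x => w x * ‖(ψ + φ) x‖ ^ 2) μ)
    (hsub : Integrable (fun x => w x * ‖(ψ - φ) x‖ ^ 2) μ)
    (hψ : Integrable (fun x => w x * ‖ψ x‖ ^ 2) μ) (hφ : Integrable (fun x => w x * ‖φ x‖ ^ 2) μ) :
    ∫ x, w x * ‖(ψ + φ) x‖ ^ 2 ∂μ + ∫ x, w x * ‖(ψ - φ) x‖ ^ 2 ∂μ
      = 2 * (∫ x, w x * ‖ψ x‖ ^ 2 ∂μ + ∫ x, w x * ‖φ x‖ ^ 2 ∂μ) := by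
  rw [← integral_add hadd hsub, ← integral_add hψ hφ, ← integral_const_mul]
  refine integral_congr_ae ?_
  filter_upwards [Lp.coeFn_add ψ φ, Lp.coeFn_sub ψ φ] with x hxadd hxsub
  rw [hxadd, hxsub, Pi.add_apply, Pi.sub_apply]
  linear_combination w x * parallelogram_law_with_norm ℂ (ψ x) (φ x)

end WeightedNormSq

section FormDomain

variable {d N : ℕ}

theorem integrable_test_smul {φ : Config d N → ℝ} (hφ : Continuous φ) (hs : HasCompactSupport φ)
    (ψ : Wave d N) : Integrable fun X => φ X • ψ X :=
  ((Lp.memLp ψ).locallyIntegrable one_le_two).integrable_smul_left_of_hasCompactSupport hφ hs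

theorem integral_test_smul_add {φ : Config d N → ℝ} (hφ : Continuous φ) (hs : HasCompactSupport φ)
    (ψ χ : Wave d N) :
    ∫ X, φ X • (ψ + χ) X = (∫ X, φ X • ψ X) + ∫ X, φ X • χ X := by
  rw [← integral_add (integrable_test_smul hφ hs ψ) (integrable_test_smul hφ hs χ)]
  refine integral_congr_ae ?_
  filter_upwards [Lp.coeFn_add ψ χ] with X hX
  rw [hX, Pi.add_apply, smul_add]

theorem integral_test_smul_smul (φ : Config d N → ℝ) (c : ℂ) (ψ : Wave d N) :
    ∫ X, φ X • (c • ψ) X = c * ∫ X, φ X • ψ X := by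
  rw [← integral_const_mul]
  refine integral_congr_ae ?_
  filter_upwards [Lp.coeFn_smul c ψ] with X hX
  rw [hX, Pi.smul_apply, smul_eq_mul, mul_smul_comm]

namespace IsWeakPartial

variable {i : Fin N × Fin d} {ψ φ g h : Wave d N}

theorem unique (hg : IsWeakPartial i ψ g) (hh : IsWeakPartial i ψ h) : g = h :=
  Lp.ext <| ae_eq_of_integral_contDiff_smul_eq ((Lp.memLp g).locallyIntegrable one_le_two)
    ((Lp.memLp h).locallyIntegrable one_le_two) fun χ hχ hs =>
      neg_injective ((hg χ hχ hs).symm.trans (hh χ hχ hs))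

theorem add (hg : IsWeakPartial i ψ g) (hh : IsWeakPartial i φ h) :
    IsWeakPartial i (ψ + φ) (g + h) := by
  intro χ hχ hs
  have hχ' : Continuous fun X => fderiv ℝ χ X (EuclideanSpace.single i 1) :=
    (hχ.continuous_fderiv (by simp)).clm_apply continuous_const
  rw [integral_test_smul_add hχ' (hs.fderiv_apply ℝ _), integral_test_smul_add hχ.continuous hs,
    hg χ hχ hs, hh χ hχ hs, neg_add]

theorem smul (c : ℂ) (hg : IsWeakPartial i ψ g) : IsWeakPartial i (c • ψ) (c • g) := by
  intro χ hχ hs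
  rw [integral_test_smul_smul, integral_test_smul_smul, hg χ hχ hs, mul_neg]

theorem weakPartial_eq (hg : IsWeakPartial i ψ g) : weakPartial i ψ = g := by
  have h : ∃ g, IsWeakPartial i ψ g := ⟨g, hg⟩
  rw [weakPartial, dif_pos h]
  exact h.choose_spec.unique hg

end IsWeakPartial

theorem InH1.isWeakPartial {ψ : Wave d N} (h : InH1 ψ) (i : Fin N × Fin d) :
    IsWeakPartial i ψ (weakPartial i ψ) := by
  obtain ⟨g, hg⟩ := h i
  rwa [hg.weakPartial_eq]

variable {W : Config d N → ℝ}

/-- The form domain of `-Δ + W` as a subspace of `L²`. -/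
def formDomain (W : Config d N → ℝ) (hW : AEStronglyMeasurable W) : Submodule ℂ (Wave d N) where
  carrier := {ψ | FormDomain W ψ}
  zero_mem' := ⟨fun i => ⟨0, fun φ _ _ => by simp⟩, by simp⟩
  add_mem' hψ hφ := ⟨fun i => ⟨_, (hψ.1.isWeakPartial i).add (hφ.1.isWeakPartial i)⟩,
    integrable_mul_norm_sq_add hW hψ.2 hφ.2⟩
  smul_mem' c ψ hψ := ⟨fun i => ⟨_, (hψ.1.isWeakPartial i).smul c⟩,
    (hψ.2.const_mul _).congr (mul_norm_sq_smul_ae_eq W c ψ).symm⟩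

variable (hW : AEStronglyMeasurable W)

/-- The partial derivative `∂_i` as a linear map on the form domain. -/
def weakPartialₗ (i : Fin N × Fin d) : formDomain W hW →ₗ[ℂ] Wave d N where
  toFun ψ := weakPartial i ψ.1
  map_add' ψ φ :=
    ((ψ.2.1.isWeakPartial i).add (φ.2.1.isWeakPartial i)).weakPartial_eq
  map_smul' c ψ := ((ψ.2.1.isWeakPartial i).smul c).weakPartial_eq

theorem weakPartialₗ_apply (i : Fin N × Fin d) (ψ : formDomain W hW) :
    weakPartialₗ hW i ψ = weakPartial i (ψ : Wave d N) := rfl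

theorem isQuadratic_potential :
    IsQuadratic fun ψ : formDomain W hW => ∫ X, W X * ‖(ψ : Wave d N) X‖ ^ 2 where
  smul c ψ := by
    rw [← integral_const_mul]
    exact integral_congr_ae (mul_norm_sq_smul_ae_eq W c ψ.1)
  parallelogram ψ φ :=
    integral_mul_norm_sq_parallelogram (ψ + φ).2.2 (ψ - φ).2.2 ψ.2.2 φ.2.2

theorem isQuadratic_freeForm : IsQuadratic fun ψ : formDomain W hW => freeForm W ψ :=
  (IsQuadratic.sum fun i _ => .norm_sq (weakPartialₗ hW i)).add (isQuadratic_potential hW)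

theorem quasiMeasurePreserving_pos (j : Fin N) :
    Measure.QuasiMeasurePreserving (pos (d := d) j) volume volume := by
  let L : Config d N →ₗ[ℝ] EuclideanSpace ℝ (Fin d) :=
    { toFun := pos j
      map_add' := fun _ _ => rfl
      map_smul' := fun _ _ => rfl }
  have hL : Function.Surjective L := fun x => ⟨WithLp.toLp 2 fun p => x p.2, rfl⟩
  obtain ⟨c, -, hc⟩ := L.exists_map_addHaar_eq_smul_addHaar volume volume hL
  refine ⟨L.continuous_of_finiteDimensional.measurable, ?_⟩
  change Measure.map L volume ≪ volume
  rw [hc]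
  exact Measure.smul_absolutelyContinuous

end FormDomain

/-! ### The field operators -/

section SqrtExt

variable {𝔥 : Type*} [NormedAddCommGroup 𝔥] [InnerProductSpace ℂ 𝔥]

theorem applyOp_eq_of_mem_graph {T : 𝔥 →ₗ.[ℂ] 𝔥} {x y : 𝔥} (h : (x, y) ∈ T.graph) :
    applyOp T x = y := by
  have hx := LinearPMap.mem_domain_of_mem_graph h
  rw [applyOp, dif_pos hx]
  exact ((LinearPMap.image_iff hx).2 h).symm

variable [CompleteSpace 𝔥]

theorem inner_comm_of_mem_graph {T : 𝔥 →ₗ.[ℂ] 𝔥} (hT : IsSelfAdjoint T) {x y u v : 𝔥}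
    (hx : (x, u) ∈ T.graph) (hy : (y, v) ∈ T.graph) : ⟪u, y⟫_ℂ = ⟪x, v⟫_ℂ := by
  obtain ⟨x, rfl, rfl⟩ := T.mem_graph_iff.1 hx
  obtain ⟨y, rfl, rfl⟩ := T.mem_graph_iff.1 hy
  have h := LinearPMap.adjoint_isFormalAdjoint (T := T) hT.dense_domain
  rw [LinearPMap.isSelfAdjoint_def.1 hT] at h
  exact h x y

namespace IsPositiveSqrt

variable {ω : Dispersion 𝔥} {σ : 𝔥 →ₗ.[ℂ] 𝔥} (hσ : IsPositiveSqrt σ ω.op)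

include hσ in
theorem mem_graph_applyOp (x : ω.op.domain) :
    ((x : 𝔥), applyOp σ x) ∈ σ.graph ∧ (applyOp σ x, ω.op x) ∈ σ.graph := by
  obtain ⟨u, hxu, hux⟩ := (hσ.sq x (ω.op x)).1 (ω.op.mem_graph x)
  rw [applyOp_eq_of_mem_graph hxu]
  exact ⟨hxu, hux⟩

/-- The square root of `ω`, which is isometric for the scalar product `⟨x, ω y⟩`. -/
def isometry : ω.SmoothVec →ₗᵢ[ℂ] 𝔥 where
  toFun x := applyOp σ (ω.toDomain x : 𝔥)
  map_add' x y := applyOp_eq_of_mem_graph <|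
    σ.graph.add_mem (hσ.mem_graph_applyOp (ω.toDomain x)).1 (hσ.mem_graph_applyOp (ω.toDomain y)).1
  map_smul' c x := applyOp_eq_of_mem_graph <|
    σ.graph.smul_mem c (hσ.mem_graph_applyOp (ω.toDomain x)).1
  norm_map' x := by
    obtain ⟨hxu, hux⟩ := hσ.mem_graph_applyOp (ω.toDomain x)
    refine (sq_eq_sq₀ (norm_nonneg _) (norm_nonneg _)).1 ?_
    calc ‖applyOp σ (ω.toDomain x : 𝔥)‖ ^ 2
        = RCLike.re ⟪applyOp σ (ω.toDomain x : 𝔥), applyOp σ (ω.toDomain x : 𝔥)⟫_ℂ :=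
          norm_sq_eq_re_inner _
      _ = RCLike.re ⟪(ω.toDomain x : 𝔥), ω.op (ω.toDomain x)⟫_ℂ := by
          rw [inner_comm_of_mem_graph hσ.selfAdjoint hxu hux]
      _ = ‖x‖ ^ 2 := (norm_sq_eq_re_inner (𝕜 := ℂ) x).symm

/-- The extension `ω^{1/2} : 𝔥_ω → 𝔥` as a continuous linear map. -/
def extend : ω.FieldSpace →L[ℂ] 𝔥 :=
  hσ.isometry.toContinuousLinearMap.extend UniformSpace.Completion.toComplL

theorem extend_eq_sqrtExt (z : ω.FieldSpace) : hσ.extend z = ω.sqrtExt σ z := by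
  refine congrFun (UniformSpace.Completion.extension_unique hσ.isometry.isometry.uniformContinuous
    hσ.extend.uniformContinuous fun x => ?_).symm z
  exact (hσ.isometry.toContinuousLinearMap.extend_eq
    (e := UniformSpace.Completion.toComplL (𝕜 := ℂ)) UniformSpace.Completion.denseRange_coe
    (UniformSpace.Completion.isUniformInducing_coe _) x).symm

include hσ in
theorem isCoupling_re_pairing {d : ℕ} {lam : EuclideanSpace ℝ (Fin d) → 𝔥}
    (hlam : IsFormFactor σ lam) :
    IsCoupling volume fun (z : ω.FieldSpace) x => (ω.pairing σ z (lam x)).re := by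
  have hfin : eLpNormEssSup (fun x => applyOp σ.inverse (lam x)) volume < ∞ := by
    simpa only [eLpNorm_exponent_top] using hlam.memLp_inv.2
  simp only [Dispersion.pairing, ← hσ.extend_eq_sqrtExt]
  refine .re_inner (hσ.extend.restrictScalars ℝ)
    (C := (eLpNormEssSup (fun x => applyOp σ.inverse (lam x)) volume).toReal) ?_
    fun u => hlam.memLp_inv.1.const_inner
  filter_upwards [ae_le_eLpNormEssSup (f := fun x => applyOp σ.inverse (lam x))] with x hx
  simpa only [toReal_enorm] using ENNReal.toReal_mono hfin.ne hx

end IsPositiveSqrt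

end SqrtExt

/-! ### Momentum integrals -/

section Radial

variable {E : Type*} [NormedAddCommGroup E] [NormedSpace ℝ E] [FiniteDimensional ℝ E]
  [Nontrivial E] [MeasurableSpace E] [BorelSpace E] {μ : Measure E} [μ.IsAddHaarMeasure]

theorem integrableOn_norm_preimage_iff {F : Type*} [NormedAddCommGroup F] [NormedSpace ℝ F]
    {f : ℝ → F} {s : Set ℝ} (hs : MeasurableSet s) :
    IntegrableOn (fun x => f ‖x‖) (norm ⁻¹' s) μ
      ↔ IntegrableOn (fun y => y ^ (Module.finrank ℝ E - 1) • f y) (s ∩ Ioi 0) := by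
  rw [← integrable_indicator_iff (measurable_norm hs), ← integrableOn_indicator_iff hs]
  exact (integrable_fun_norm_addHaar μ (f := s.indicator f)).trans
    (by rw [indicator_smul])

theorem memLp_two_norm_rpow_restrict {s : Set ℝ} (hs : MeasurableSet s) {p q : ℝ}
    (hq : Module.finrank ℝ E - 1 + 2 * p = q) (h : IntegrableOn (fun y => y ^ q) (s ∩ Ioi 0)) :
    MemLp (fun x : E => ((‖x‖ ^ p : ℝ) : ℂ)) 2 (μ.restrict (norm ⁻¹' s)) := by
  have hmeas : Measurable fun x : E => ((‖x‖ ^ p : ℝ) : ℂ) :=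
    Complex.measurable_ofReal.comp (measurable_norm.pow_const _)
  rw [memLp_two_iff_integrable_sq_norm hmeas.aestronglyMeasurable]
  simp only [Complex.norm_real, Real.norm_eq_abs, sq_abs]
  refine (integrableOn_norm_preimage_iff (f := fun y : ℝ => (y ^ p) ^ 2) hs).2
    (h.congr_fun (fun y hy => ?_) (hs.inter measurableSet_Ioi))
  have hy0 : 0 < y := hy.2
  have hdim : ((Module.finrank ℝ E - 1 : ℕ) : ℝ) = Module.finrank ℝ E - 1 := by
    rw [Nat.cast_sub Module.finrank_pos, Nat.cast_one]
  rw [smul_eq_mul, ← Real.rpow_natCast, ← Real.rpow_mul_natCast hy0.le, ← Real.rpow_add hy0, hdim,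
    Nat.cast_two, mul_comm p, hq]

end Radial

section PlaneWave

variable {E : Type*} [NormedAddCommGroup E] [InnerProductSpace ℝ E]

theorem norm_exp_neg_I_mul (t : ℝ) : ‖Complex.exp (-Complex.I * t)‖ = 1 := by
  simp [Complex.norm_exp]

theorem norm_mul_planeWave (h : E → ℂ) (k x : E) :
    ‖h k * Complex.exp (-Complex.I * (⟪k, x⟫_ℝ : ℝ))‖ = ‖h k‖ := by
  rw [norm_mul, norm_exp_neg_I_mul, mul_one]

variable [MeasurableSpace E] [BorelSpace E] {μ : Measure E} {h : E → ℂ}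

theorem memLp_mul_planeWave {p : ℝ≥0∞} (hh : MemLp h p μ) (x : E) :
    MemLp (fun k => h k * Complex.exp (-Complex.I * (⟪k, x⟫_ℝ : ℝ))) p μ :=
  hh.of_le (hh.1.mul (Continuous.aestronglyMeasurable (by fun_prop)))
    (.of_forall fun k => (norm_mul_planeWave h k x).le)

theorem inner_toLp_mul_planeWave (hh : MemLp h 2 μ) (z : Lp ℂ 2 μ) (x : E) :
    ⟪z, (memLp_mul_planeWave hh x).toLp⟫_ℂ
      = ∫ k, (starRingEnd ℂ) (z k) * (h k * Complex.exp (-Complex.I * (⟪k, x⟫_ℝ : ℝ))) ∂μ := by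
  rw [L2.inner_def]
  refine integral_congr_ae ?_
  filter_upwards [(memLp_mul_planeWave hh x).coeFn_toLp] with k hk
  rw [hk, RCLike.inner_apply']

theorem continuous_inner_toLp_mul_planeWave (hh : MemLp h 2 μ) (z : Lp ℂ 2 μ) :
    Continuous fun x => ⟪z, (memLp_mul_planeWave hh x).toLp⟫_ℂ := by
  have hz : MemLp (fun k => (starRingEnd ℂ) (z k)) 2 μ := (Lp.memLp z).star
  simp only [inner_toLp_mul_planeWave hh]
  refine continuous_of_dominated (bound := fun k => ‖(starRingEnd ℂ) (z k)‖ * ‖h k‖)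
    (fun x => hz.1.mul (memLp_mul_planeWave hh x).1) (fun x => .of_forall fun k => ?_)
    (hz.norm.integrable_mul hh.norm) (.of_forall fun k => by fun_prop)
  rw [norm_mul, norm_mul_planeWave]

theorem isCoupling_re_integral_planeWave [SecondCountableTopology E] {ν : Measure E}
    {S : Set E} (hh : MemLp h 2 (μ.restrict S)) :
    IsCoupling ν fun (z : Lp ℂ 2 μ) x => (∫ k in S, (starRingEnd ℂ) (z k) *
      (h k * Complex.exp (-Complex.I * (⟪k, x⟫_ℝ : ℝ))) ∂μ).re := by
  let R := LpToLpRestrictCLM E ℂ ℂ μ 2 S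
  have hR : ∀ (z : Lp ℂ 2 μ) x, ∫ k in S, (starRingEnd ℂ) (z k) *
      (h k * Complex.exp (-Complex.I * (⟪k, x⟫_ℝ : ℝ))) ∂μ
        = ⟪R z, (memLp_mul_planeWave hh x).toLp⟫_ℂ := fun z x => by
    rw [inner_toLp_mul_planeWave hh]
    refine integral_congr_ae ?_
    filter_upwards [LpToLpRestrictCLM_coeFn ℂ S z] with k hk
    rw [hk]
  simp only [hR]
  refine .re_inner (R.restrictScalars ℝ) (C := ‖hh.toLp‖) (.of_forall fun x => ?_)
    fun z => (continuous_inner_toLp_mul_planeWave hh z).aestronglyMeasurable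
  refine Lp.norm_le_norm_of_ae_le ?_
  filter_upwards [(memLp_mul_planeWave hh x).coeFn_toLp, hh.coeFn_toLp] with k hwave hk
  rw [hwave, hk, norm_mul_planeWave]

end PlaneWave

section Polaron

variable {d : ℕ}

theorem isCoupling_polaronLow (hd : 1 ≤ d) (r : ℝ) :
    IsCoupling volume (polaronLow (d := d) r) := by
  have : Nonempty (Fin d) := ⟨⟨0, hd⟩⟩
  have hint : IntegrableOn (fun y : ℝ => y ^ (0 : ℝ)) (Iic r ∩ Ioi 0) := by
    simp [Iic_inter_Ioi]
  have hradial := memLp_two_norm_rpow_restrict (E := EuclideanSpace ℝ (Fin d)) (μ := volume)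
    measurableSet_Iic (p := -(((d : ℝ) - 1) / 2))
    (by rw [finrank_euclideanSpace_fin]; ring) hint
  have h := (isCoupling_re_integral_planeWave (ν := volume) hradial).const_mul 2
  simp only [← mul_assoc] at h
  exact h

theorem isCoupling_polaronHigh (hd : 1 ≤ d) {r : ℝ} (hr : 0 < r) (l : Fin d) :
    IsCoupling volume fun z => polaronHigh (d := d) r z l := by
  have : Nonempty (Fin d) := ⟨⟨0, hd⟩⟩
  have hint : IntegrableOn (fun y : ℝ => y ^ (-2 : ℝ)) (Ioi r ∩ Ioi 0) :=
    (integrableOn_Ioi_rpow_of_lt (by norm_num) hr).mono_set inter_subset_left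
  have hradial := memLp_two_norm_rpow_restrict (E := EuclideanSpace ℝ (Fin d)) (μ := volume)
    measurableSet_Ioi (p := -(((d : ℝ) + 1) / 2))
    (by rw [finrank_euclideanSpace_fin]; ring) hint
  have hdir : MemLp (fun k : EuclideanSpace ℝ (Fin d) => Complex.I * ((k l / ‖k‖ : ℝ) : ℂ)
      * ((‖k‖ ^ (-(((d : ℝ) + 1) / 2)) : ℝ) : ℂ)) 2 (volume.restrict (norm ⁻¹' Ioi r)) := by
    refine hradial.of_le (Measurable.aestronglyMeasurable (by fun_prop)) (.of_forall fun k => ?_)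
    rw [norm_mul, norm_mul, Complex.norm_I, one_mul, Complex.norm_real, norm_div, norm_norm]
    exact mul_le_of_le_one_left (norm_nonneg _)
      (div_le_one_of_le₀ (PiLp.norm_apply_le k l) (norm_nonneg _))
  have h := (isCoupling_re_integral_planeWave (ν := volume) hdir).const_mul 2
  simp only [← mul_assoc] at h
  unfold polaronHigh
  simp only [← mul_assoc]
  exact h

end Polaron

/-! ### The three models -/

section Models

attribute [local instance] InnerProductSpace.complexToReal

namespace IsCoupling

variable {K : Type*} [NormedAddCommGroup K] [InnerProductSpace ℂ K]
variable {X : Type*} [MeasurableSpace X] {μ : Measure X} {a : K → X → ℝ}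
variable {V : Type*} [AddCommGroup V] [Module ℂ V]

theorem isFieldCoupledForm_mul_norm_sq (ha : IsCoupling μ a) (A : V →ₗ[ℂ] Lp ℂ 2 μ) :
    IsFieldCoupledForm fun z v => ∫ x, a z x * ‖A v x‖ ^ 2 ∂μ := by
  simp only [ha.integral_mul_norm_sq]
  exact .re_inner A A ha.mul

theorem isFieldCoupledForm_re_conj_mul_mul (ha : IsCoupling μ a) (A B : V →ₗ[ℂ] Lp ℂ 2 μ) :
    IsFieldCoupledForm fun z v =>
      (∫ x, (starRingEnd ℂ) (A v x) * (a z x : ℂ) * B v x ∂μ).re := by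
  simp only [ha.integral_conj_mul_mul]
  exact .re_inner A B ha.mul

theorem isFieldCoupledForm_norm_sq_add (ha : IsCoupling μ a) (b : ℂ) (A B : V →ₗ[ℂ] Lp ℂ 2 μ) :
    IsFieldCoupledForm fun z v => ∫ x, ‖b * A v x + (a z x : ℂ) * B v x‖ ^ 2 ∂μ := by
  simp only [ha.integral_norm_sq_add]
  exact .norm_sq_add (b • A) B ha.mul

end IsCoupling

instance separableSpace_wave (d N : ℕ) : TopologicalSpace.SeparableSpace (Wave d N) := by
  have : Fact ((2 : ℝ≥0∞) ≠ ∞) := ⟨ENNReal.ofNat_ne_top⟩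
  infer_instance

variable {𝔥 : Type*} [NormedAddCommGroup 𝔥] [InnerProductSpace ℂ 𝔥] [CompleteSpace 𝔥]
variable {ω : Dispersion 𝔥} {σ : 𝔥 →ₗ.[ℂ] 𝔥} {N : ℕ}

theorem isQuasiClassicalEnergy_nelson (hσ : IsPositiveSqrt σ ω.op) {d : ℕ}
    {W : Config d N → ℝ} (hW : AEStronglyMeasurable W) {lam : EuclideanSpace ℝ (Fin d) → 𝔥}
    (hlam : IsFormFactor σ lam) : IsQuasiClassicalEnergy (nelsonEnergy ω σ W lam) := by
  have hV (j : Fin N) : IsCoupling volume fun (z : ω.FieldSpace) (X : Config d N) =>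
      nelsonPotential ω σ lam z (pos j X) :=
    ((hσ.isCoupling_re_pairing hlam).const_mul 2).comp (quasiMeasurePreserving_pos j)
  exact ⟨formDomain W hW, _, (IsFieldCoupledForm.of_isQuadratic (isQuadratic_freeForm hW)).add
    (.sum fun j _ => (hV j).isFieldCoupledForm_mul_norm_sq (formDomain W hW).subtype),
    fun ψ z => if_pos ψ.2, fun ψ hψ z => if_neg hψ⟩

theorem isQuasiClassicalEnergy_polaron {d : ℕ} (hd : 1 ≤ d) {W : Config d N → ℝ}
    (hW : AEStronglyMeasurable W) (α : ℝ) {r : ℝ} (hr : 0 < r) :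
    IsQuasiClassicalEnergy (polaronEnergy W α r) := by
  have hlow (j : Fin N) : IsCoupling volume fun (z : PolaronField d) (X : Config d N) =>
      polaronLow r z (pos j X) :=
    (isCoupling_polaronLow hd r).comp (quasiMeasurePreserving_pos j)
  have hhigh (j : Fin N) (l : Fin d) : IsCoupling volume
      fun (z : PolaronField d) (X : Config d N) => -2 * polaronHigh r z l (pos j X) :=
    ((isCoupling_polaronHigh hd hr l).comp (quasiMeasurePreserving_pos j)).const_mul (-2)
  refine ⟨formDomain W hW, _, (IsFieldCoupledForm.of_isQuadratic (isQuadratic_freeForm hW)).add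
    (.const_mul (.sum (s := Finset.univ) fun j _ =>
      ((hlow j).isFieldCoupledForm_mul_norm_sq (formDomain W hW).subtype).add
      (.sum (s := Finset.univ) fun l _ => (hhigh j l).isFieldCoupledForm_re_conj_mul_mul
        (formDomain W hW).subtype (weakPartialₗ hW (j, l)))) (Real.sqrt_nonneg α)),
    fun ψ z => (if_pos ψ.2).trans ?_, fun ψ hψ z => if_neg hψ⟩
  have hfactor (j : Fin N) (l : Fin d) :
      (∫ X, (starRingEnd ℂ) ((ψ : Wave d N) X) * ((-2 * polaronHigh r z l (pos j X) : ℝ) : ℂ)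
          * weakPartial (j, l) (ψ : Wave d N) X).re
        = -2 * (∫ X, (starRingEnd ℂ) ((ψ : Wave d N) X) * (polaronHigh r z l (pos j X) : ℂ)
          * weakPartial (j, l) (ψ : Wave d N) X).re := by
    rw [← Complex.re_ofReal_mul, ← integral_const_mul]
    push_cast
    simp only [mul_assoc, mul_left_comm _ (-2 : ℂ)]
  simp only [Submodule.subtype_apply, weakPartialₗ_apply, hfactor, ← Finset.mul_sum,
    Submodule.coe_norm]
  simp only [neg_mul, sub_eq_add_neg]

theorem isQuasiClassicalEnergy_pauliFierz (hσ : IsPositiveSqrt σ ω.op)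
    {W : Config 3 N → ℝ} (hW : AEStronglyMeasurable W) {m : Fin N → ℝ} (hm : ∀ j, 0 ≤ m j) (e : ℝ)
    {lam : Fin N → Fin 3 → EuclideanSpace ℝ (Fin 3) → 𝔥} (hlam : ∀ j l, IsFormFactor σ (lam j l)) :
    IsQuasiClassicalEnergy (pauliFierzEnergy ω σ W m e lam) := by
  have hA (j : Fin N) (l : Fin 3) : IsCoupling volume
      fun (z : ω.FieldSpace) (X : Config 3 N) => e * vectorPotential ω σ (lam j) z l (pos j X) :=
    (((hσ.isCoupling_re_pairing (hlam j l)).const_mul 2).comp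
      (quasiMeasurePreserving_pos j)).const_mul e
  exact ⟨formDomain W hW, _, (IsFieldCoupledForm.sum fun j _ => .const_mul
    (.sum fun l _ => (hA j l).isFieldCoupledForm_norm_sq_add (-Complex.I)
      (weakPartialₗ hW (j, l)) (formDomain W hW).subtype)
      (one_div_nonneg.2 (mul_nonneg zero_le_two (hm j)))).add
    (.of_isQuadratic (isQuadratic_potential hW)), fun ψ z => if_pos ψ.2, fun ψ hψ z => if_neg hψ⟩

end Models

end QuasiClassical

end

open QuasiClassical in
theorem mainTheorem10_general {𝔥 : Type*} [NormedAddCommGroup 𝔥] [InnerProductSpace ℂ 𝔥]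
    [CompleteSpace 𝔥] (ω : Dispersion 𝔥) (σ : 𝔥 →ₗ.[ℂ] 𝔥) (hσ : IsPositiveSqrt σ ω.op)
    (d N : ℕ) (hd : 1 ≤ d) :
    (∀ (W : Config d N → ℝ) (lam : EuclideanSpace ℝ (Fin d) → 𝔥),
      AEStronglyMeasurable W → IsFormFactor σ lam →
      [∃ p, IsQcMinimizer (nelsonEnergy ω σ W lam) p,
        ∃ ψ, IsPekarMinimizer (pekarInf (nelsonEnergy ω σ W lam)) ψ,
        ∃ m, IsSvmMinimizer (nelsonEnergy ω σ W lam) m,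
        ∃ p, IsPmMinimizer (nelsonEnergy ω σ W lam) p].TFAE ∧
      ∀ m, IsSvmMinimizer (nelsonEnergy ω σ W lam) m →
        IsConcentratedOnMinimizers (nelsonEnergy ω σ W lam) m) ∧
    (∀ (W : Config d N → ℝ) (α r : ℝ), AEStronglyMeasurable W → 0 < α → 0 < r →
      [∃ p, IsQcMinimizer (polaronEnergy W α r) p,
        ∃ ψ, IsPekarMinimizer (pekarInf (polaronEnergy W α r)) ψ,
        ∃ m, IsSvmMinimizer (polaronEnergy W α r) m,
        ∃ p, IsPmMinimizer (polaronEnergy W α r) p].TFAE ∧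
      ∀ m, IsSvmMinimizer (polaronEnergy W α r) m →
        IsConcentratedOnMinimizers (polaronEnergy W α r) m) ∧
    (∀ (W : Config 3 N → ℝ) (m : Fin N → ℝ) (e : ℝ)
      (lam : Fin N → Fin 3 → EuclideanSpace ℝ (Fin 3) → 𝔥),
      AEStronglyMeasurable W → (∀ j, 0 < m j) → (∀ j l, IsFormFactor σ (lam j l)) →
      [∃ p, IsQcMinimizer (pauliFierzEnergy ω σ W m e lam) p,
        ∃ ψ, IsPekarMinimizer (pekarCritical (pauliFierzEnergy ω σ W m e lam)) ψ,
        ∃ 𝔪, IsSvmMinimizer (pauliFierzEnergy ω σ W m e lam) 𝔪,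
        ∃ p, IsPmMinimizer (pauliFierzEnergy ω σ W m e lam) p].TFAE ∧
      ∀ 𝔪, IsSvmMinimizer (pauliFierzEnergy ω σ W m e lam) 𝔪 →
        IsConcentratedOnMinimizers (pauliFierzEnergy ω σ W m e lam) 𝔪) := by
  refine ⟨fun W lam hW hlam => ?_, fun W α r hW _ hr => ?_, fun W m e lam hW hm hlam => ?_⟩
  · have hE := isQuasiClassicalEnergy_nelson hσ hW hlam
    exact ⟨hE.tfae_exists_minimizer_pekarInf,
      fun _ => IsSvmMinimizer.isConcentratedOnMinimizers hE.isExtQuadratic⟩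
  · have hE := isQuasiClassicalEnergy_polaron hd hW α hr
    exact ⟨hE.tfae_exists_minimizer_pekarInf,
      fun _ => IsSvmMinimizer.isConcentratedOnMinimizers hE.isExtQuadratic⟩
  · have hE := isQuasiClassicalEnergy_pauliFierz hσ hW (fun j => (hm j).le) e hlam
    exact ⟨hE.tfae_exists_minimizer_pekarCritical,
      fun _ => IsSvmMinimizer.isConcentratedOnMinimizers hE.isExtQuadratic⟩

open QuasiClassical in
theorem mainTheorem10 {𝔥 : Type*} [NormedAddCommGroup 𝔥] [InnerProductSpace ℂ 𝔥]
    [CompleteSpace 𝔥] [TopologicalSpace.SeparableSpace 𝔥]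
    (ω : Dispersion 𝔥) (σ : 𝔥 →ₗ.[ℂ] 𝔥) (hσ : IsPositiveSqrt σ ω.op)
    (d N : ℕ) (hd : 1 ≤ d ∧ d ≤ 3) (hN : 1 ≤ N) :
    -- the Nelson model
    (∀ (W : Config d N → ℝ) (lam : EuclideanSpace ℝ (Fin d) → 𝔥),
      IsPotential W → IsFormFactor σ lam →
      [∃ p, IsQcMinimizer (nelsonEnergy ω σ W lam) p,
        ∃ ψ, IsPekarMinimizer (pekarInf (nelsonEnergy ω σ W lam)) ψ,
        ∃ m, IsSvmMinimizer (nelsonEnergy ω σ W lam) m,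
        ∃ p, IsPmMinimizer (nelsonEnergy ω σ W lam) p].TFAE ∧
      ∀ m, IsSvmMinimizer (nelsonEnergy ω σ W lam) m →
        IsConcentratedOnMinimizers (nelsonEnergy ω σ W lam) m) ∧
    -- the Fröhlich polaron
    (∀ (W : Config d N → ℝ) (α r : ℝ), IsPotential W → 0 < α → 0 < r →
      [∃ p, IsQcMinimizer (polaronEnergy W α r) p,
        ∃ ψ, IsPekarMinimizer (pekarInf (polaronEnergy W α r)) ψ,
        ∃ m, IsSvmMinimizer (polaronEnergy W α r) m,
        ∃ p, IsPmMinimizer (polaronEnergy W α r) p].TFAE ∧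
      ∀ m, IsSvmMinimizer (polaronEnergy W α r) m →
        IsConcentratedOnMinimizers (polaronEnergy W α r) m) ∧
    -- the Pauli-Fierz model, in three dimensions
    (∀ (W : Config 3 N → ℝ) (m : Fin N → ℝ) (e : ℝ)
      (lam : Fin N → Fin 3 → EuclideanSpace ℝ (Fin 3) → 𝔥),
      IsPotential W → (∀ j, 0 < m j) → (∀ j l, IsFormFactor σ (lam j l)) →
      [∃ p, IsQcMinimizer (pauliFierzEnergy ω σ W m e lam) p,
        ∃ ψ, IsPekarMinimizer (pekarCritical (pauliFierzEnergy ω σ W m e lam)) ψ,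
        ∃ 𝔪, IsSvmMinimizer (pauliFierzEnergy ω σ W m e lam) 𝔪,
        ∃ p, IsPmMinimizer (pauliFierzEnergy ω σ W m e lam) p].TFAE ∧
      ∀ 𝔪, IsSvmMinimizer (pauliFierzEnergy ω σ W m e lam) 𝔪 →
        IsConcentratedOnMinimizers (pauliFierzEnergy ω σ W m e lam) 𝔪) := by
  obtain ⟨nelson, polaron, pauliFierz⟩ := mainTheorem10_general ω σ hσ d N hd.1
  exact ⟨fun W lam hW => nelson W lam hW.1.aestronglyMeasurable,
    fun W α r hW => polaron W α r hW.1.aestronglyMeasurable,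
    fun W m e lam hW => pauliFierz W m e lam hW.1.aestronglyMeasurable⟩
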